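/- **Theorem (PSR with low GEC).** *Setting.* An episode consists of $H$ steps with observations $o_h\in\mathcal O$ and actions $a_h\in\mathcal A$, $\mathcal A$ finite and non-empty; $\tau_h=(o_1,a_1,\dots,o_h,a_h)$. A model $f$ consists of conditional probabilities (or, with respect to a fixed $\sigma$-finite measure on $\mathcal O$, densities) $\mathbb P_f(o_h\mid\tau_{h-1})$ and non-negative rewards $R_{h,f}(o_h,a_h)$ with $\sum_{h=1}^H R_{h,f}\le 1$. For a history-dependent randomized policy $\pi$ put $\mathbb P_f(\tau_H)=\prod_h\mathbb P_f(o_h\mid\tau_{h-1})$, $\pi(\tau_H)=\prod_h\pi_h(a_h\mid\tau_{h-1},o_h)$, $\mathbb P_f^\pi(\tau_H)=\mathbb P_f(\tau_H)\pi(\tau_H)$, let $V_f^\pi$ be the expected total reward, $V_f=\max_\pi V_f^\pi$, and let $\pi_f$ be an optimal policy of $f$. Let $\mathcal H$ be a class of models which contains the true model $f^*$; write $V^\pi=V_{f^*}^\pi$, $V^*=V_{f^*}$. For each $h$ let $\mathcal U_h$ be a non-empty set of tests $t=(o_{h:h+W-1},a_{h:h+W-2})$ (the episode may be completed by a dummy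 observation $o_{H+1}$) which is a core test set for every $f\in\mathcal H$: for every test $t$ from step $h$ there are weights $m_f(t)$ with $\mathbb P_f(t\mid\tau_{h-1})=\langle m_f(t),[\mathbb P_f(u\mid\tau_{h-1})]_{u\in\mathcal U_h}\rangle$ for all $\tau_{h-1}$ (a sum; an integral over $\mathcal U_h$ if $\mathcal U_h$ is infinite). Here $\mathbb P_f(t\mid\tau_{h-1})$ is the probability (density) of the observations of $t$ when its actions are executed after $\tau_{h-1}$, and $0$ after an unreachable history. Let $\mathcal U_{A,h}$ be the set of action sequences of the tests in $\mathcal U_h$. *Exploration policies.* For $0\le h\le H-1$, $\pi_{\exp}(f,h)=\pi_f\circ_h\mathrm{Unif}(\mathcal A)\circ_{h+1}\mathrm{Unif}(\mathcal U_{A,h+1})$ follows $\pi_f$ for the first $h-1$ steps, takes a uniform action at step $h$ (if $h\ge1$), then executes an action sequence drawn uniformly from $\mathcal U_{A,h+1}$, and then behaves in an arbitrary way that is fixed by $f$, $h$, the drawn sequence and the history of the episode. *GEC.* With $D_H^2(P,Q)=\frac12\int(\sqrt{dP}-\sqrt{dQ})^2$, let $d_{\mathrm{GEC}}$ be the smallest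 $d\ge0$ such that for all $f^1,\dots,f^T\in\mathcal H$ $$\sum_{t=1}^T\big(V_{f^t}-V^{\pi_{f^t}}\big)\le\Big[d\sum_{h=0}^{H-1}\sum_{t=1}^T\sum_{s=1}^{t-1}D_H^2\Big(\mathbb P_{f^t}^{\pi_{\exp}(f^s,h)}(\tau_H),\mathbb P_{f^*}^{\pi_{\exp}(f^s,h)}(\tau_H)\Big)\Big]^{1/2}+\sqrt{dHT}.$$ *Prior.* For a prior $p^0$ on $\mathcal H$ and $c>0$ let $\omega(c,p^0)=\inf_{\epsilon>0}[c\epsilon-\log p^0(\mathcal H(\epsilon))]$, where $\mathcal H(\epsilon)=\{f\in\mathcal H: V^*-V_f\le\epsilon,\ \sup_\pi\mathrm{KL}(\mathbb P_{f^*}^\pi(\tau_H)\,\|\,\mathbb P_f^\pi(\tau_H))\le\epsilon\}$. *Algorithm.* In each round $t=1,\dots,T$, draw $f^t$ from the optimistic posterior $$p^t(f)\propto p^0(f)\exp\Big(\gamma V_f+\sum_{s=1}^{t-1}\sum_{h=0}^{H-1}\eta\log\mathbb P_f(\tau_h^s)\Big),$$ and then, for every $h=0,\dots,H-1$, execute $\pi_{\exp}(f^t,h)$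 for one episode and record its full trajectory $\tau_h^t$. Put $\mathrm{Reg}(T)=\sum_{t=1}^T(V^*-V^{\pi_{f^t}})$. *Claim.* Let $\omega=\omega(HT,p^0)<\infty$, $d_{\mathrm{GEC}}>0$, $\eta=1/2$ and $\gamma=2\sqrt{\omega T/d_{\mathrm{GEC}}}$; if $d_{\mathrm{GEC}}<1$, assume moreover $\gamma\le HT/2$. Then the posteriors are almost surely well defined, and $$\mathbb E[\mathrm{Reg}(T)]\le2\sqrt{d_{\mathrm{GEC}}\cdot HT\cdot(H+\omega(HT,p^0))}.$$ The same form of bound holds if regret is counted for each of the $HT$ executed episodes (the regret of round $t$ counted $H$ times): $H\cdot\mathbb E[\mathrm{Reg}(T)]\le2\sqrt{d_{\mathrm{GEC}}\cdot H\cdot(HT)\cdot(H+\omega(HT,p^0))}$. If $\mathcal H$ is finite and $p^0$ is the uniform distribution on $\mathcal H$, both bounds hold with $\log|\mathcal H|$ in place of $\omega(HT,p^0)$ under the square roots. -/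

import Mathlib

open MeasureTheory ProbabilityTheory
open scoped NNReal ENNReal

noncomputable section

namespace PSR

/-! Steps are numbered `0, …, H - 1` here instead of `1, …, H`. -/

/-- Full trajectories `τ_H = (o_1, a_1, …, o_H, a_H)`. -/
abbrev Traj (O A : Type*) (H : ℕ) : Type _ := Fin H → O × A

/-- The part of a trajectory that precedes step `h`. -/
def hist {O A : Type*} {n : ℕ} (τ : Fin n → O × A) (h : Fin n) : Fin h → O × A :=
  fun i => τ (Fin.castLE h.isLt.le i)

/-- An action sequence `(a_h, …, a_{h+W-1})` of some length `W`. -/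
abbrev ActSeq (A : Type*) : Type _ := Σ W : ℕ, Fin W → A

/-- A test `(o_h, …, o_{h+W}; a_h, …, a_{h+W-1})`, which has one observation more than it has
actions. -/
abbrev Test (O A : Type*) : Type _ := Σ W : ℕ, (Fin (W + 1) → O) × (Fin W → A)

/-- The action sequence of a test. -/
def Test.acts {O A : Type*} (t : Test O A) : ActSeq A := ⟨t.1, t.2.2⟩

/-- A test that starts at step `h` has to end within the episode. If its actions exhaust the
episode (`h + W = H`), its last observation is the dummy one that follows the last action. -/
def Test.Fits {O A : Type*} (H : ℕ) (h : Fin H) (t : Test O A) : Prop := h + t.1 ≤ H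

theorem finite_acts {O A : Type*} [Fintype A] {H : ℕ} {h : Fin H} {U : Set (Test O A)} (hU : ∀ t ∈ U, t.Fits H h) :
    (Test.acts '' U).Finite := by
  refine ((Finset.range (H + 1)).sigma fun W =>
    (Finset.univ : Finset (Fin W → A))).finite_toSet.subset ?_
  rintro _ ⟨t, ht, rfl⟩
  have := hU t ht
  simp only [Test.Fits] at this
  simp only [Finset.coe_sigma, Set.mem_sigma_iff, Finset.coe_range, Set.mem_Iio, Test.acts,
    Finset.coe_univ, Set.mem_univ, and_true]
  omega

/-- An episodic model with horizon `H`: the conditional densities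
`ℙ(o_h ∣ τ_{h-1})` with respect to a reference measure `ν` on the observations (the counting
measure in the tabular case, where these are probabilities), and the reward functions. -/
structure Model {O : Type*} [MeasurableSpace O] (ν : Measure O)
    (A : Type*) [MeasurableSpace A] (H : ℕ) where
  dens : (h : Fin H) → (Fin h → O × A) → O → ℝ≥0
  measurable_dens : ∀ h : Fin H, Measurable fun x : (Fin h → O × A) × O => dens h x.1 x.2
  lintegral_dens : ∀ h τ, ∫⁻ o, (dens h τ o : ℝ≥0∞) ∂ν = 1
  reward : Fin H → O → A → ℝ
  measurable_reward : ∀ h, Measurable fun x : O × A => reward h x.1 x.2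
  reward_nonneg : ∀ h o a, 0 ≤ reward h o a
  sum_reward_le : ∀ τ : Traj O A H, ∑ h, reward h (τ h).1 (τ h).2 ≤ 1

/-- A history-dependent randomized policy; `prob h τ o a` is `π_h(a ∣ τ_{h-1}, o_h)`. -/
structure Policy (O A : Type*) [MeasurableSpace O] [MeasurableSpace A] [Fintype A] (H : ℕ) where
  prob : (h : Fin H) → (Fin h → O × A) → O → A → ℝ≥0
  measurable_prob : ∀ (h : Fin H) (a : A), Measurable fun x : (Fin h → O × A) × O => prob h x.1 x.2 a
  sum_prob : ∀ h τ o, ∑ a, prob h τ o a = 1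

section Basic

variable {O A : Type*} [MeasurableSpace O] [MeasurableSpace A] {ν : Measure O} {H : ℕ}

/-- The reference measure on trajectories: `ν` for observations, counting for actions. -/
def refMeasure (ν : Measure O) (A : Type*) [MeasurableSpace A] (H : ℕ) : Measure (Traj O A H) :=
  Measure.pi fun _ => ν.prod Measure.count

/-- `ℙ(τ_H) = ∏_h ℙ(o_h ∣ τ_{h-1})`. -/
def Model.traj (M : Model ν A H) (τ : Traj O A H) : ℝ≥0 :=
  ∏ h, M.dens h (hist τ h) (τ h).1

/-- `ℙ(τ)` for the history `τ` that precedes step `h`. -/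
def Model.histDens (M : Model ν A H) (h : Fin H) (τ : Fin h → O × A) : ℝ≥0 :=
  ∏ k : Fin h, M.dens (Fin.castLE h.isLt.le k) (hist τ k) (τ k).1

open Classical in
/-- `ℙ(t ∣ τ)`: the probability (density) of observing the observations of the test `t` when its
actions are executed from step `h` on, after the history `τ`; it is `0` after an unreachable
history. A dummy observation after the last step has probability one. -/
def Model.testDens (M : Model ν A H) (h : Fin H) (τ : Fin h → O × A) (t : Test O A) : ℝ≥0 :=
  if M.histDens h τ = 0 then 0
  else ∏ i : Fin (t.1 + 1),
    if hk : (h : ℕ) + i < H then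
      M.dens ⟨h + i, hk⟩
        (Fin.append τ fun j : Fin i =>
          (t.2.1 (Fin.castLE i.isLt.le j), t.2.2 (Fin.castLE (Nat.le_of_lt_succ i.isLt) j)))
        (t.2.1 i)
    else 1

/-- `U` is a core test set at step `h`: the probability of every test is, with weights that do not
depend on the history, a linear combination of those of the tests in `U`. For a finite `U` the
integral is the finite sum `⟨m(t), [ℙ(u ∣ τ)]_{u ∈ U}⟩`. -/
def IsCoreTestSet (M : Model ν A H) (h : Fin H) (U : Set (Test O A)) : Prop :=
  ∃ ρ : Measure (Test O A), ρ Uᶜ = 0 ∧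
    ∀ t : Test O A, t.Fits H h → ∃ m : Test O A → ℝ, ∀ τ : Fin h → O × A,
      Integrable (fun u => m u * M.testDens h τ u) ρ ∧
      (M.testDens h τ t : ℝ) = ∫ u, m u * M.testDens h τ u ∂ρ

/-- The law on trajectories with density `ℙ(τ) w(τ)`. -/
def Model.law (M : Model ν A H) (w : Traj O A H → ℝ≥0) : Measure (Traj O A H) :=
  (refMeasure ν A H).withDensity fun τ => ((M.traj τ * w τ : ℝ≥0) : ℝ≥0∞)

/-- The squared Hellinger distance of two measures with densities `p` and `q` with respect to
`μ`. -/
def hellingerSq {X : Type*} [MeasurableSpace X] (μ : Measure X) (p q : X → ℝ≥0) : ℝ :=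
  1 / 2 * ∫ x, (Real.sqrt (p x) - Real.sqrt (q x)) ^ 2 ∂μ

variable [Fintype A]

/-- `π(τ_H) = ∏_h π_h(a_h ∣ τ_{h-1}, o_h)`. -/
def Policy.weight (π : Policy O A H) (τ : Traj O A H) : ℝ≥0 :=
  ∏ h, π.prob h (hist τ h) (τ h).1 (τ h).2

/-- The value `V^π` in the model `M`; here `M.law π.weight` is `ℙ^π(τ_H) = ℙ(τ_H) π(τ_H)`. -/
def Model.value (M : Model ν A H) (π : Policy O A H) : ℝ :=
  ∫ τ, ∑ h, M.reward h (τ h).1 (τ h).2 ∂(M.law π.weight)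

/-- The optimal value of the model `M`. -/
def Model.optValue (M : Model ν A H) : ℝ := ⨆ π : Policy O A H, M.value π

open Classical in
/-- The exploration policy for a fixed action sequence `u`: follow `π` before the (one-based)
step `h`, take a uniform action at step `h`, execute `u` from step `h + 1` on, and follow `tail`
afterwards. For `h = 0` the action sequence starts at once. -/
def Policy.explore [Nonempty A] (π tail : Policy O A H) (h : Fin H) (u : ActSeq A) :
    Policy O A H where
  prob k τ o a :=
    if (k : ℕ) + 1 < h then π.prob k τ o a
    else if (k : ℕ) + 1 = h then (Fintype.card A : ℝ≥0)⁻¹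
    else if hi : (k : ℕ) - h < u.1 then (if u.2 ⟨k - h, hi⟩ = a then 1 else 0)
    else tail.prob k τ o a
  measurable_prob k a := by
    split_ifs
    · exact π.measurable_prob k a
    · exact measurable_const
    · exact measurable_const
    · exact measurable_const
    · exact tail.measurable_prob k a
  sum_prob k τ o := by
    split_ifs with h1 h2 h3
    · exact π.sum_prob k τ o
    · simp
    · simp
    · exact tail.sum_prob k τ o

end Basic

/-- A class `𝓗` of PSR models (each hypothesis is a model) with common core test sets, together
with the policies that the algorithm uses: an optimal policy `π_f` of each model, and the arbitrary
policy `tail f h u` that the exploration policy follows after its prescribed part, which ends with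
the action sequence `u`. The last four fields say that everything depends measurably on `f`. -/
structure PSRClass (𝓗 : Type*) [MeasurableSpace 𝓗] {O : Type*} [MeasurableSpace O]
    (ν : Measure O) (A : Type*) [MeasurableSpace A] [Fintype A] (H : ℕ) where
  model : 𝓗 → Model ν A H
  tests : Fin H → Set (Test O A)
  tests_nonempty : ∀ h, (tests h).Nonempty
  tests_core : ∀ f h, IsCoreTestSet (model f) h (tests h)
  tests_fit : ∀ h, ∀ t ∈ tests h, t.Fits H h
  optPolicy : 𝓗 → Policy O A H
  optPolicy_optimal : ∀ f (π : Policy O A H), (model f).value π ≤ (model f).value (optPolicy f)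
  tail : 𝓗 → Fin H → ActSeq A → Policy O A H
  measurable_dens : ∀ h : Fin H, Measurable fun x : 𝓗 × (Fin h → O × A) × O =>
    (model x.1).dens h x.2.1 x.2.2
  measurable_reward : ∀ h : Fin H, Measurable fun x : 𝓗 × O × A =>
    (model x.1).reward h x.2.1 x.2.2
  measurable_optPolicy : ∀ (h : Fin H) (a : A), Measurable fun x : 𝓗 × (Fin h → O × A) × O =>
    (optPolicy x.1).prob h x.2.1 x.2.2 a
  measurable_tail : ∀ (k : Fin H) (u : ActSeq A) (h : Fin H) (a : A),
    Measurable fun x : 𝓗 × (Fin h → O × A) × O => (tail x.1 k u).prob h x.2.1 x.2.2 a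

namespace PSRClass

variable {𝓗 O A : Type*} [MeasurableSpace 𝓗] [MeasurableSpace O] [MeasurableSpace A]
  [Fintype A] [Nonempty A] {ν : Measure O} {H : ℕ}

/-- The finite set of action sequences of the core tests; `C.coreActs h` with
`h = 0, …, H - 1` is `𝒰_{A,h+1}` in the one-based numbering of steps. -/
def coreActs (C : PSRClass 𝓗 ν A H) (h : Fin H) : Finset (ActSeq A) :=
  (finite_acts (C.tests_fit h)).toFinset

/-- The probabilities `π(τ_H)` of the exploration policy
`π_exp(f, h) = π_f ∘_h Unif(A) ∘_{h+1} Unif(𝒰_{A,h+1})`, which draws an action sequence `u`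
uniformly and then executes it. -/
def expWeight (C : PSRClass 𝓗 ν A H) (f : 𝓗) (h : Fin H) (τ : Traj O A H) : ℝ≥0 :=
  ((C.coreActs h).card : ℝ≥0)⁻¹ *
    ∑ u ∈ C.coreActs h, ((C.optPolicy f).explore (C.tail f h u) h u).weight τ

/-- The training error of `g` on the data of round `f` at step `h`: the squared Hellinger distance
of `ℙ_g^{π_exp(f,h)}` and `ℙ_{f*}^{π_exp(f,h)}` on full trajectories. -/
def trainErr (C : PSRClass 𝓗 ν A H) (fstar g f : 𝓗) (h : Fin H) : ℝ :=
  hellingerSq (refMeasure ν A H)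
    (fun τ => (C.model g).traj τ * C.expWeight f h τ)
    (fun τ => (C.model fstar).traj τ * C.expWeight f h τ)

/-- The generalized eluder coefficient over `T` rounds, with burn-in cost `√(d H T)`. -/
def gec (C : PSRClass 𝓗 ν A H) (fstar : 𝓗) (T : ℕ) : ℝ :=
  sInf {d : ℝ | 0 ≤ d ∧ ∀ f : Fin T → 𝓗,
    ∑ t, ((C.model (f t)).optValue - (C.model fstar).value (C.optPolicy (f t))) ≤
      √(d * ∑ h : Fin H, ∑ t : Fin T, ∑ s ∈ Finset.Iio t, C.trainErr fstar (f t) (f s) h) +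
      √(d * H * T)}

/-- The models `f` with `V^* - V_f ≤ ε` and `sup_π KL(ℙ_{f*}^π ‖ ℙ_f^π) ≤ ε`. -/
def nearby (C : PSRClass 𝓗 ν A H) (fstar : 𝓗) (ε : ℝ) : Set 𝓗 :=
  {f | (C.model fstar).optValue - (C.model f).optValue ≤ ε ∧
    ∀ π : Policy O A H,
      InformationTheory.klDiv ((C.model fstar).law π.weight) ((C.model f).law π.weight) ≤
        ENNReal.ofReal ε}

/-- `ω(c, p⁰) = inf_{ε > 0} [c ε - log p⁰(𝓗(ε))]`, with `- log 0 = ∞`. -/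
def omega (C : PSRClass 𝓗 ν A H) (fstar : 𝓗) (p₀ : Measure 𝓗) (c : ℝ) : EReal :=
  ⨅ (ε : ℝ) (_ : 0 < ε), ((c * ε : ℝ) : EReal) - ENNReal.log (p₀ (C.nearby fstar ε))

/-- The unnormalized posterior density `exp(γ V_f + ∑_{s,h} η log ℙ_f(τ_h^s))` with respect to the
prior, given the trajectories of `t` rounds (one for each `h`); it vanishes when some
`ℙ_f(τ_h^s)` does. -/
def postWeight (C : PSRClass 𝓗 ν A H) (η γ : ℝ) {t : ℕ} (D : Fin t → Fin H → Traj O A H)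
    (f : 𝓗) : ℝ≥0∞ :=
  ENNReal.ofReal (Real.exp (γ * (C.model f).optValue)) *
    ∏ s, ∏ h, (((C.model f).traj (D s h) ^ η : ℝ≥0) : ℝ≥0∞)

/-- The optimistic posterior. -/
def posterior (C : PSRClass 𝓗 ν A H) (p₀ : Measure 𝓗) (η γ : ℝ) {t : ℕ}
    (D : Fin t → Fin H → Traj O A H) : Measure 𝓗 :=
  (∫⁻ f, C.postWeight η γ D f ∂p₀)⁻¹ • p₀.withDensity (C.postWeight η γ D)

/-- The joint law of the hypotheses `f^1, …, f^t` and of the trajectories `τ_h^s` that the first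
`t` rounds of the algorithm produce in the environment `f*`: in each round, `f` is drawn from the
posterior, and then, for each `h`, one trajectory is collected with `π_exp(f, h)`. -/
def runLaw (C : PSRClass 𝓗 ν A H) (fstar : 𝓗) (p₀ : Measure 𝓗) (η γ : ℝ) :
    (t : ℕ) → Measure (Fin t → 𝓗 × (Fin H → Traj O A H))
  | 0 => Measure.dirac fun i => i.elim0
  | t + 1 => (runLaw C fstar p₀ η γ t).bind fun past =>
      (C.posterior p₀ η γ fun s => (past s).2).bind fun f =>
        (Measure.pi fun h => (C.model fstar).law (C.expWeight f h)).map fun D =>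
          Fin.snoc (α := fun _ => 𝓗 × (Fin H → Traj O A H)) past (f, D)

/-- The expectation of `Reg(T) = ∑_{t ≤ T} (V^* - V^{π_{f^t}})` for `T` rounds of the algorithm. -/
def expectedRegret (C : PSRClass 𝓗 ν A H) (fstar : 𝓗) (p₀ : Measure 𝓗) (η γ : ℝ) (T : ℕ) : ℝ :=
  ∫ run, ∑ t, ((C.model fstar).optValue - (C.model fstar).value (C.optPolicy (run t).1))
    ∂(C.runLaw fstar p₀ η γ T)

end PSRClass

end PSR

end

/-! The regret splits as ∑ (V^* - V_{f^t}) + ∑ (V_{f^t} - V^{π_{f^t}}). By the definition of the GEC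
d, the second sum is at most √(d E) + √(d H T), where E is the total Hellinger training error, and
√(d E) ≤ E/γ + dγ/4. What remains is to bound the expectation of the potential γ ∑ (V^* - V_{f^t}) +
E; its increment in a round is the posterior mean of `roundGap`.

Here η = 1/2 matters. Relative to f^*, the posterior weighs f by exp(γ (V_f - V^*)) times the root
of the likelihood ratio, `rootLik`. One root ratio has as its mean the Hellinger affinity 1 - D_H² ≤
exp(-D_H²), so for each fixed f the product of `rootLik` and exp(`pastErr`) is a supermartingale
over the rounds (`lintegral_rootLik_mul_exp_le`). Let g be the posterior mean of `roundGap` and Z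
the normalizing constant. By Jensen, exp(g) Z is at most the prior mean of that product, so E[exp(g)
Z] ≤ 1, which heuristically says E[g] ≤ E[-log Z]. Restricting Z to the part 𝓗(ε) of the prior gives
E[g] ≤ γε + tHε/2 - log p⁰(𝓗(ε)) after t rounds (`integral_le_of_exp_mul_lintegral_le`,
`integral_roundGap_le`). Summation over the rounds, with γ ≤ HT, bounds the potential by (3/2) T ω.

Since γ² d = 4 ω T, the terms (3/2) T ω/γ and dγ/4 add up to (5/4) √(d ω T). Together with √(d H T)
this is at most 2 √(d T (H + ω)), which is sharper by √H than the bound for rounds and equivalent to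
the bound for episodes. If γ > HT, then d ≥ 1, and the trivial bound T on the regret is already
small enough. -/

set_option linter.unusedSectionVars false

noncomputable section

namespace PSR

/-! ### Densities on trajectories from conditional densities -/

section Chain

variable {Ω O A : Type*} [MeasurableSpace Ω] [MeasurableSpace O] [MeasurableSpace A] {H : ℕ}

theorem measurable_hist (h : Fin H) : Measurable fun τ : Traj O A H => hist τ h :=
  measurable_pi_lambda _ fun _ => measurable_pi_apply _

theorem measurable_prod_hist {q : Ω → (h : Fin H) → (Fin h → O × A) → O × A → ℝ≥0}
    (hq : ∀ h : Fin H, Measurable fun x : Ω × (Fin h → O × A) × (O × A) => q x.1 h x.2.1 x.2.2) :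
    Measurable fun x : Ω × Traj O A H => ∏ h, q x.1 h (hist x.2 h) (x.2 h) :=
  Finset.measurable_prod _ fun h _ => (hq h).comp <| measurable_fst.prodMk <|
    ((measurable_hist h).comp measurable_snd).prodMk
      ((measurable_pi_apply h).comp measurable_snd)

theorem hist_snoc_castSucc {n : ℕ} (τ : Fin n → O × A) (x : O × A) (h : Fin n) :
    hist (Fin.snoc (α := fun _ => O × A) τ x) h.castSucc = hist τ h := by
  funext i
  have : Fin.castLE (h.castSucc).isLt.le i = Fin.castSucc (Fin.castLE h.isLt.le i) := rfl
  simp only [hist, this]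
  exact Fin.snoc_castSucc (α := fun _ => O × A) ..

theorem hist_snoc_last {n : ℕ} (τ : Fin n → O × A) (x : O × A) :
    hist (Fin.snoc (α := fun _ => O × A) τ x) (Fin.last n) = τ := by
  funext i
  exact Fin.snoc_castSucc (α := fun _ => O × A) ..

/-- A product of conditional densities is a density. -/
theorem lintegral_prod_hist (μ : Measure (O × A)) [SigmaFinite μ] :
    ∀ {n : ℕ} {q : (h : Fin n) → (Fin h → O × A) → O × A → ℝ≥0∞},
    (∀ h : Fin n, Measurable fun x : (Fin h → O × A) × (O × A) => q h x.1 x.2) →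
    (∀ h τ, ∫⁻ x, q h τ x ∂μ = 1) →
    ∫⁻ τ : Fin n → O × A, ∏ h, q h (hist τ h) (τ h) ∂(Measure.pi fun _ => μ) = 1
  | 0, q, _, _ => by simp
  | n + 1, q, hq, h1 => by
    have e := (measurePreserving_piFinSuccAbove (fun _ : Fin (n + 1) => μ) (Fin.last n)).symm
    have hm : Measurable fun τ : Fin (n + 1) → O × A => ∏ h, q h (hist τ h) (τ h) :=
      Finset.measurable_prod _ fun h _ =>
        (hq h).comp ((measurable_hist h).prodMk (measurable_pi_apply h))
    rw [← e.lintegral_comp hm]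
    have key : ∀ y : (O × A) × (Fin n → O × A),
        ∏ h, q h (hist ((MeasurableEquiv.piFinSuccAbove (fun _ => O × A) (Fin.last n)).symm y) h)
          ((MeasurableEquiv.piFinSuccAbove (fun _ => O × A) (Fin.last n)).symm y h) =
        q (Fin.last n) y.2 y.1 * ∏ h : Fin n, q h.castSucc (hist y.2 h) (y.2 h) := by
      intro y
      have hy : (MeasurableEquiv.piFinSuccAbove (fun _ => O × A) (Fin.last n)).symm y =
          Fin.snoc (α := fun _ => O × A) y.2 y.1 := by
        simp [MeasurableEquiv.piFinSuccAbove, Fin.insertNthEquiv, Fin.insertNth_last']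
      rw [hy, Fin.prod_univ_castSucc, mul_comm]
      congr 1
      · rw [hist_snoc_last, Fin.snoc_last]
      · refine Finset.prod_congr rfl fun h _ => ?_
        rw [hist_snoc_castSucc, Fin.snoc_castSucc]
    simp_rw [key]
    -- The last step is integrated first: its factor depends on the whole past, but no other factor
    -- depends on it.
    rw [lintegral_prod_symm _ (by
      refine Measurable.aemeasurable (Measurable.mul ?_ ?_)
      · exact (hq (Fin.last n)).comp (measurable_snd.prodMk measurable_fst)
      · refine Finset.measurable_prod _ fun h _ => ?_
        exact (hq h.castSucc).comp (((measurable_hist h).prodMk (measurable_pi_apply h)).comp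
          measurable_snd))]
    have h2 : ∀ y : Fin n → O × A, ∫⁻ x, q (Fin.last n) y x *
        ∏ h : Fin n, q h.castSucc (hist y h) (y h) ∂μ =
        ∏ h : Fin n, q h.castSucc (hist y h) (y h) := by
      intro y
      have hm' : Measurable fun x => q (Fin.last n) y x :=
        (hq (Fin.last n)).comp measurable_prodMk_left
      have h1' : ∫⁻ x, q (Fin.last n) y x ∂μ = 1 := h1 (Fin.last n) y
      rw [lintegral_mul_const _ hm', h1', one_mul]
    simp_rw [h2]
    exact lintegral_prod_hist μ (q := fun h => q h.castSucc) (fun h => hq h.castSucc)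
      fun h => h1 h.castSucc

end Chain

/-! ### Trajectory laws of a model under a policy -/

section Laws

variable {O A : Type*} [MeasurableSpace O] [MeasurableSpace A]
  [DiscreteMeasurableSpace A] [Fintype A] {ν : Measure O} [SigmaFinite ν] {H : ℕ}

instance : SigmaFinite (refMeasure ν A H) := by
  unfold refMeasure; infer_instance

theorem Model.measurable_traj (M : Model ν A H) : Measurable M.traj :=
  Finset.measurable_prod _ fun h _ => (M.measurable_dens h).comp <|
    (measurable_hist h).prodMk (measurable_fst.comp (measurable_pi_apply h))

theorem measurable_eval_action {Ω : Type*} [MeasurableSpace Ω] {β : Type*} [MeasurableSpace β]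
    {q : Ω → A → β} (hq : ∀ a, Measurable fun x => q x a) :
    Measurable fun x : Ω × A => q x.1 x.2 :=
  measurable_from_prod_countable_left hq

theorem Policy.measurable_weight (π : Policy O A H) : Measurable π.weight :=
  Finset.measurable_prod _ fun h _ =>
    (measurable_eval_action (Ω := (Fin h → O × A) × O)
      (q := fun x a => π.prob h x.1 x.2 a) (π.measurable_prob h)).comp
    (((measurable_hist h).prodMk (measurable_fst.comp (measurable_pi_apply h))).prodMk
      (measurable_snd.comp (measurable_pi_apply h)))

theorem Model.lintegral_traj_mul_weight (M : Model ν A H) (π : Policy O A H) :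
    ∫⁻ τ, ((M.traj τ * π.weight τ : ℝ≥0) : ℝ≥0∞) ∂(refMeasure ν A H) = 1 := by
  have h := lintegral_prod_hist (ν.prod (Measure.count : Measure A)) (n := H)
    (q := fun h τ x => ((M.dens h τ x.1 * π.prob h τ x.1 x.2 : ℝ≥0) : ℝ≥0∞)) ?_ ?_
  · rw [← h]
    refine lintegral_congr fun τ => ?_
    rw [← ENNReal.ofNNReal_finsetProd, Finset.prod_mul_distrib]
    rfl
  · intro h
    refine Measurable.coe_nnreal_ennreal (Measurable.mul ?_ ?_)
    · exact (M.measurable_dens h).comp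
        (measurable_fst.prodMk (measurable_fst.comp measurable_snd))
    · exact (measurable_eval_action (Ω := (Fin h → O × A) × O)
        (q := fun x a => π.prob h x.1 x.2 a) (π.measurable_prob h)).comp
        ((measurable_fst.prodMk (measurable_fst.comp measurable_snd)).prodMk
          (measurable_snd.comp measurable_snd))
  · intro h τ
    rw [lintegral_prod]
    · simp only [lintegral_count, tsum_fintype]
      rw [← M.lintegral_dens h τ]
      refine lintegral_congr fun o => ?_
      rw [← ENNReal.ofNNReal_finsetSum, ← Finset.mul_sum, π.sum_prob, mul_one]
    · refine (Measurable.coe_nnreal_ennreal (Measurable.mul ?_ ?_)).aemeasurable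
      · exact (M.measurable_dens h).comp (measurable_const.prodMk measurable_fst)
      · exact (measurable_eval_action (q := fun o a => π.prob h τ o a)
          fun a => (π.measurable_prob h a).comp (measurable_const.prodMk measurable_id))

theorem Model.isProbabilityMeasure_law {M : Model ν A H} {w : Traj O A H → ℝ≥0}
    (hw : ∫⁻ τ, ((M.traj τ * w τ : ℝ≥0) : ℝ≥0∞) ∂(refMeasure ν A H) = 1) :
    IsProbabilityMeasure (M.law w) :=
  ⟨by rw [Model.law, withDensity_apply _ .univ, Measure.restrict_univ, hw]⟩

instance (M : Model ν A H) (π : Policy O A H) : IsProbabilityMeasure (M.law π.weight) :=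
  Model.isProbabilityMeasure_law (M.lintegral_traj_mul_weight π)

end Laws

/-! ### Hellinger distance and affinity of probability densities -/

section Hellinger

variable {X : Type*} [MeasurableSpace X] {μ : Measure X} {p q : X → ℝ≥0}

theorem integrable_of_lintegral_eq_one (hp : Measurable p) (hp1 : ∫⁻ x, (p x : ℝ≥0∞) ∂μ = 1) :
    Integrable (fun x => (p x : ℝ)) μ := by
  refine ⟨hp.coe_nnreal_real.aestronglyMeasurable, ?_⟩
  rw [hasFiniteIntegral_iff_enorm]
  simp [hp1]

theorem integral_of_lintegral_eq_one (hp : Measurable p) (hp1 : ∫⁻ x, (p x : ℝ≥0∞) ∂μ = 1) :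
    ∫ x, (p x : ℝ) ∂μ = 1 := by
  rw [integral_eq_lintegral_of_nonneg_ae (f := fun x => (p x : ℝ)) (.of_forall fun x => (p x).2)
    hp.coe_nnreal_real.aestronglyMeasurable]
  simp [hp1]

theorem integrable_sqrt_mul (hp : Measurable p) (hq : Measurable q)
    (hp1 : ∫⁻ x, (p x : ℝ≥0∞) ∂μ = 1) (hq1 : ∫⁻ x, (q x : ℝ≥0∞) ∂μ = 1) :
    Integrable (fun x => √(p x) * √(q x)) μ := by
  refine ((integrable_of_lintegral_eq_one hp hp1).add
    (integrable_of_lintegral_eq_one hq hq1)).mono' ?_ (.of_forall fun x => ?_)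
  · exact (hp.coe_nnreal_real.sqrt.mul hq.coe_nnreal_real.sqrt).aestronglyMeasurable
  · rw [Real.norm_of_nonneg (by positivity), Pi.add_apply]
    nlinarith [sq_nonneg (√(p x : ℝ) - √(q x)), Real.sq_sqrt (p x).coe_nonneg,
      Real.sq_sqrt (q x).coe_nonneg, (p x).coe_nonneg, (q x).coe_nonneg]

theorem hellingerSq_eq (hp : Measurable p) (hq : Measurable q)
    (hp1 : ∫⁻ x, (p x : ℝ≥0∞) ∂μ = 1) (hq1 : ∫⁻ x, (q x : ℝ≥0∞) ∂μ = 1) :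
    hellingerSq μ p q = 1 - ∫ x, √(p x) * √(q x) ∂μ := by
  have h : ∀ x, (√(p x : ℝ) - √(q x)) ^ 2 = ((p x : ℝ) + q x) - 2 * (√(p x) * √(q x)) := by
    intro x
    nlinarith [Real.sq_sqrt (p x).coe_nonneg, Real.sq_sqrt (q x).coe_nonneg]
  have hip := integrable_of_lintegral_eq_one hp hp1
  have hiq := integrable_of_lintegral_eq_one hq hq1
  simp_rw [hellingerSq, h]
  have hipq : Integrable (fun x => (p x : ℝ) + q x) μ := hip.add hiq
  rw [integral_sub hipq ((integrable_sqrt_mul hp hq hp1 hq1).const_mul 2),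
    integral_add hip hiq, integral_const_mul, integral_of_lintegral_eq_one hp hp1,
    integral_of_lintegral_eq_one hq hq1]
  ring

theorem hellingerSq_nonneg : 0 ≤ hellingerSq μ p q :=
  mul_nonneg (by norm_num) (integral_nonneg fun _ => sq_nonneg _)

theorem hellingerSq_le_one (hp : Measurable p) (hq : Measurable q)
    (hp1 : ∫⁻ x, (p x : ℝ≥0∞) ∂μ = 1) (hq1 : ∫⁻ x, (q x : ℝ≥0∞) ∂μ = 1) :
    hellingerSq μ p q ≤ 1 := by
  rw [hellingerSq_eq hp hq hp1 hq1, sub_le_self_iff]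
  exact integral_nonneg fun _ => by positivity

end Hellinger

/-! ### Likelihood ratios: Hellinger affinity and Kullback–Leibler closeness -/

section Ratio

variable {O A : Type*} [MeasurableSpace O] [MeasurableSpace A]
  [DiscreteMeasurableSpace A] [Fintype A] {ν : Measure O} [SigmaFinite ν] {H : ℕ}

/-- The square root of the likelihood ratio `ℙ_N(τ_H) / ℙ_M(τ_H)`. -/
def Model.rootRatio (M N : Model ν A H) (τ : Traj O A H) : ℝ≥0 :=
  NNReal.sqrt (N.traj τ / M.traj τ)

theorem Model.measurable_rootRatio (M N : Model ν A H) : Measurable (M.rootRatio N) :=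
  NNReal.continuous_sqrt.measurable.comp (N.measurable_traj.div M.measurable_traj)

theorem Model.measurable_traj_mul (M : Model ν A H) {w : Traj O A H → ℝ≥0} (hw : Measurable w) :
    Measurable fun τ => M.traj τ * w τ :=
  M.measurable_traj.mul hw

theorem Model.ae_law_iff (M : Model ν A H) {w : Traj O A H → ℝ≥0} (hw : Measurable w)
    {P : Traj O A H → Prop} :
    (∀ᵐ τ ∂(M.law w), P τ) ↔ ∀ᵐ τ ∂(refMeasure ν A H), M.traj τ * w τ ≠ 0 → P τ := by
  rw [Model.law, ae_withDensity_iff (M.measurable_traj_mul hw).coe_nnreal_ennreal]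
  simp only [ne_eq, ENNReal.coe_eq_zero]

theorem Model.ae_traj_pos (M : Model ν A H) {w : Traj O A H → ℝ≥0} (hw : Measurable w) :
    ∀ᵐ τ ∂(M.law w), 0 < M.traj τ :=
  (M.ae_law_iff hw).2 <| .of_forall fun _ h => pos_of_ne_zero (left_ne_zero_of_mul h)

/-- The policy weight cancels in the likelihood ratio: √(N/M) · M w = √(N w) √(M w), whose integral
is the affinity. This identity is the reason for η = 1/2. -/
theorem Model.lintegral_rootRatio (M N : Model ν A H) {w : Traj O A H → ℝ≥0} (hw : Measurable w)
    (hM : ∫⁻ τ, ((M.traj τ * w τ : ℝ≥0) : ℝ≥0∞) ∂(refMeasure ν A H) = 1)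
    (hN : ∫⁻ τ, ((N.traj τ * w τ : ℝ≥0) : ℝ≥0∞) ∂(refMeasure ν A H) = 1) :
    ∫⁻ τ, (M.rootRatio N τ : ℝ≥0∞) ∂(M.law w) =
      ENNReal.ofReal (1 - hellingerSq (refMeasure ν A H) (fun τ => N.traj τ * w τ)
        fun τ => M.traj τ * w τ) := by
  have hmM := M.measurable_traj_mul hw
  have hmN := N.measurable_traj_mul hw
  rw [hellingerSq_eq hmN hmM hN hM, sub_sub_cancel, ofReal_integral_eq_lintegral_ofReal
    (integrable_sqrt_mul hmN hmM hN hM) (.of_forall fun _ => by positivity), Model.law,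
    lintegral_withDensity_eq_lintegral_mul _ hmM.coe_nnreal_ennreal
      (M.measurable_rootRatio N).coe_nnreal_ennreal]
  refine lintegral_congr fun τ => ?_
  simp only [Pi.mul_apply, ← ENNReal.coe_mul, Model.rootRatio]
  rw [← Real.coe_sqrt, ← Real.coe_sqrt, ← NNReal.coe_mul, ENNReal.ofReal_coe_nnreal]
  congr 1
  simp only [NNReal.sqrt_mul, NNReal.sqrt_div]
  -- Where `M.traj` vanishes, the quotient has the default value 0, and both sides vanish.
  by_cases h : M.traj τ = 0
  · simp [h]
  · have h' : NNReal.sqrt (M.traj τ) ≠ 0 := by simpa using h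
    have e1 := NNReal.mul_self_sqrt (M.traj τ)
    have e2 := NNReal.mul_self_sqrt (w τ)
    field_simp
    rw [sq, sq, e1, e2]
    ring

theorem Model.rootRatio_pos {M N : Model ν A H} {τ : Traj O A H} (hM : 0 < M.traj τ)
    (hN : 0 < N.traj τ) : 0 < M.rootRatio N τ :=
  NNReal.sqrt_pos.2 (div_pos hN hM)

/-- What closeness in Kullback–Leibler divergence gives for the logarithm of the root of the
likelihood ratio. -/
structure Model.LogClose (M N : Model ν A H) (w : Traj O A H → ℝ≥0) (c : ℝ) : Prop where
  ae_pos : ∀ᵐ τ ∂(M.law w), 0 < N.traj τ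
  integrable : Integrable (fun τ => Real.log (M.rootRatio N τ)) (M.law w)
  integral_le : ∫ τ, -Real.log (M.rootRatio N τ) ∂(M.law w) ≤ c

/-- The policy factor cancels in the density of one law with respect to the other, so the
log-likelihood ratio is -2 times the logarithm of the root ratio; this halves ε. Finiteness of the
divergence supplies absolute continuity, hence positivity, and integrability. -/
theorem Model.logClose_of_klDiv_le (M N : Model ν A H) (π : Policy O A H) {ε : ℝ} (hε : 0 ≤ ε)
    (h : InformationTheory.klDiv (M.law π.weight) (N.law π.weight) ≤ ENNReal.ofReal ε) :
    M.LogClose N π.weight (ε / 2) := by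
  have hw := π.measurable_weight
  obtain ⟨hac, hint⟩ := InformationTheory.klDiv_ne_top_iff.1 (ne_top_of_le_ne_top (by simp) h)
  have hkl : ∫ τ, llr (M.law π.weight) (N.law π.weight) τ ∂(M.law π.weight) ≤ ε := by
    rw [← InformationTheory.toReal_klDiv_of_measure_eq hac (by simp)]
    exact ENNReal.toReal_le_of_le_ofReal hε h
  have hposN : ∀ᵐ τ ∂(M.law π.weight), 0 < N.traj τ := hac.ae_le (N.ae_traj_pos hw)
  have hposN' := (M.ae_law_iff hw).1 hposN
  have hposM := M.ae_traj_pos hw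
  have hmr : Measurable fun τ => ((M.traj τ / N.traj τ : ℝ≥0) : ℝ≥0∞) :=
    (M.measurable_traj.div N.measurable_traj).coe_nnreal_ennreal
  have hdens : M.law π.weight =
      (N.law π.weight).withDensity fun τ => ((M.traj τ / N.traj τ : ℝ≥0) : ℝ≥0∞) := by
    unfold Model.law
    rw [← withDensity_mul _ (N.measurable_traj_mul hw).coe_nnreal_ennreal hmr]
    refine withDensity_congr_ae ?_
    filter_upwards [hposN'] with τ hτ
    simp only [Pi.mul_apply, ← ENNReal.coe_mul, ENNReal.coe_inj]
    -- Positivity of `N.traj` is known only where the law of `M` has positive density; elsewhere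
    -- both densities are 0.
    by_cases h0 : M.traj τ * π.weight τ = 0
    · rw [h0]
      rcases mul_eq_zero.1 h0 with h0 | h0 <;> simp [h0]
    · have := (hτ h0).ne'
      field_simp
  have hllr : llr (M.law π.weight) (N.law π.weight) =ᵐ[M.law π.weight]
      fun τ => -2 * Real.log (M.rootRatio N τ) := by
    have h1 := Measure.rnDeriv_withDensity (N.law π.weight) hmr
    rw [← hdens] at h1
    filter_upwards [hac.ae_le h1, hposN, hposM] with τ h1 h2 h3
    rw [llr, h1, Model.rootRatio, Real.coe_sqrt, Real.log_sqrt (by positivity)]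
    have h2' : (N.traj τ : ℝ) ≠ 0 := by exact_mod_cast h2.ne'
    have h3' : (M.traj τ : ℝ) ≠ 0 := by exact_mod_cast h3.ne'
    simp only [ENNReal.coe_toReal, NNReal.coe_div]
    rw [Real.log_div h2' h3', Real.log_div h3' h2']
    ring
  have hi : Integrable (fun τ => Real.log (M.rootRatio N τ)) (M.law π.weight) := by
    refine ((hint.congr hllr).const_mul (-(1 / 2))).congr (.of_forall fun τ => ?_)
    ring
  refine ⟨hposN, hi, ?_⟩
  rw [integral_congr_ae hllr, integral_const_mul] at hkl
  rw [integral_neg]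
  linarith

theorem Model.law_average (M : Model ν A H) {ι : Type*} (s : Finset ι) (c : ℝ≥0)
    {w : ι → Traj O A H → ℝ≥0} (hw : ∀ i, Measurable (w i)) :
    M.law (fun τ => c * ∑ i ∈ s, w i τ) = c • ∑ i ∈ s, M.law (w i) := by
  ext t ht
  simp only [Model.law, Measure.smul_apply, Measure.finsetSum_apply, withDensity_apply _ ht]
  rw [← lintegral_finsetSum _ fun i _ => (M.measurable_traj_mul (hw i)).coe_nnreal_ennreal]
  rw [ENNReal.smul_def, smul_eq_mul, ← lintegral_const_mul _ (Finset.measurable_sum _ fun i _ =>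
    (M.measurable_traj_mul (hw i)).coe_nnreal_ennreal)]
  refine lintegral_congr fun τ => ?_
  rw [← ENNReal.ofNNReal_finsetSum, ← ENNReal.coe_mul, ← Finset.mul_sum]
  congr 1
  ring

/-- An exploration policy draws its action sequence at random, so its weight is an average of
weights of policies, and the divergence bound is available for each of these. All three properties
are stable under averages of laws, because the integrand does not involve the weight. -/
theorem Model.LogClose.average {M N : Model ν A H} {ι : Type*} {s : Finset ι} (hs : s.Nonempty)
    {w : ι → Traj O A H → ℝ≥0} (hw : ∀ i, Measurable (w i)) {c : ℝ}
    (h : ∀ i ∈ s, M.LogClose N (w i) c) :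
    M.LogClose N (fun τ => (s.card : ℝ≥0)⁻¹ * ∑ i ∈ s, w i τ) c := by
  have hi : ∀ i ∈ s, Integrable (fun τ => Real.log (M.rootRatio N τ)) (M.law (w i)) :=
    fun i his => (h i his).integrable
  have hcard : (0 : ℝ) < s.card := by exact_mod_cast hs.card_pos
  refine ⟨?_, ?_, ?_⟩
  · rw [M.law_average s _ hw]
    refine Measure.ae_smul_measure ?_ _
    rw [ae_iff, Measure.finsetSum_apply]
    exact Finset.sum_eq_zero fun i his => ae_iff.1 (h i his).ae_pos
  · rw [M.law_average s _ hw]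
    exact (integrable_finsetSum_measure.2 hi).smul_measure_nnreal
  · rw [M.law_average s _ hw, integral_smul_nnreal_measure,
      integral_finsetSum_measure (f := fun τ => -Real.log (M.rootRatio N τ))
        fun i his => (hi i his).neg, NNReal.smul_def, smul_eq_mul,
      NNReal.coe_inv, NNReal.coe_natCast, inv_mul_le_iff₀ hcard, ← nsmul_eq_mul]
    exact Finset.sum_le_card_nsmul _ _ _ fun i his => (h i his).integral_le

end Ratio

/-! ### Measurable dependence on the model and the policy -/

section Families

variable {Ω O A : Type*} [MeasurableSpace Ω] [MeasurableSpace O] [MeasurableSpace A]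
  [DiscreteMeasurableSpace A] [Fintype A] {ν : Measure O} [SigmaFinite ν] {H : ℕ}

theorem measurable_family_traj {M : Ω → Model ν A H}
    (hM : ∀ h : Fin H, Measurable fun x : Ω × (Fin h → O × A) × O => (M x.1).dens h x.2.1 x.2.2) :
    Measurable fun x : Ω × Traj O A H => (M x.1).traj x.2 :=
  measurable_prod_hist (q := fun f h τ x => (M f).dens h τ x.1) fun h =>
    (hM h).comp (f := fun x : Ω × (Fin h → O × A) × (O × A) => (x.1, x.2.1, x.2.2.1))
      (by fun_prop)

theorem measurable_family_weight {π : Ω → Policy O A H}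
    (hπ : ∀ (h : Fin H) (a : A), Measurable fun x : Ω × (Fin h → O × A) × O =>
      (π x.1).prob h x.2.1 x.2.2 a) :
    Measurable fun x : Ω × Traj O A H => (π x.1).weight x.2 :=
  measurable_prod_hist (q := fun f h τ x => (π f).prob h τ x.1 x.2) fun h =>
    (measurable_eval_action (Ω := Ω × (Fin h → O × A) × O)
      (q := fun x a => (π x.1).prob h x.2.1 x.2.2 a) (hπ h)).comp
      (f := fun x : Ω × (Fin h → O × A) × (O × A) => ((x.1, x.2.1, x.2.2.1), x.2.2.2))
      (by fun_prop)

/-- Moving the policy from the measure into the integrand makes the value a parametric integral over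
a fixed measure, whose measurability in the parameter is standard. -/
theorem Model.value_eq (M : Model ν A H) (π : Policy O A H) :
    M.value π = ∫ τ, (M.traj τ * π.weight τ : ℝ≥0) • ∑ h, M.reward h (τ h).1 (τ h).2
      ∂(refMeasure ν A H) :=
  integral_withDensity_eq_integral_smul (M.measurable_traj_mul π.measurable_weight) _

theorem measurable_family_value {M : Ω → Model ν A H} {π : Ω → Policy O A H}
    (hM : ∀ h : Fin H, Measurable fun x : Ω × (Fin h → O × A) × O => (M x.1).dens h x.2.1 x.2.2)
    (hR : ∀ h : Fin H, Measurable fun x : Ω × O × A => (M x.1).reward h x.2.1 x.2.2)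
    (hπ : ∀ (h : Fin H) (a : A), Measurable fun x : Ω × (Fin h → O × A) × O =>
      (π x.1).prob h x.2.1 x.2.2 a) :
    Measurable fun f => (M f).value (π f) := by
  simp_rw [Model.value_eq, NNReal.smul_def, smul_eq_mul]
  have hr : Measurable fun x : Ω × Traj O A H =>
      ∑ h, (M x.1).reward h (x.2 h).1 (x.2 h).2 :=
    Finset.measurable_sum _ fun h _ =>
      (hR h).comp (f := fun x : Ω × Traj O A H => (x.1, (x.2 h).1, (x.2 h).2)) (by fun_prop)
  exact (((measurable_family_traj hM).mul (measurable_family_weight hπ)).coe_nnreal_real.mul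
    hr).stronglyMeasurable.integral_prod_right.measurable

theorem Model.value_nonneg (M : Model ν A H) (π : Policy O A H) : 0 ≤ M.value π :=
  integral_nonneg fun _ => Finset.sum_nonneg fun _ _ => M.reward_nonneg _ _ _

theorem Model.value_le_one (M : Model ν A H) (π : Policy O A H) : M.value π ≤ 1 := by
  refine (integral_mono_of_nonneg (.of_forall fun τ => ?_) (integrable_const (1 : ℝ))
    (.of_forall fun τ => M.sum_reward_le τ)).trans (by simp)
  exact Finset.sum_nonneg fun _ _ => M.reward_nonneg _ _ _

end Families

/-! ### Exploration policies and the episodes of one round -/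

namespace PSRClass

variable {𝓗 O A : Type*} [MeasurableSpace 𝓗] [MeasurableSpace O] [MeasurableSpace A]
  [DiscreteMeasurableSpace A] [Fintype A] [Nonempty A] {ν : Measure O} [SigmaFinite ν] {H : ℕ}
  (C : PSRClass 𝓗 ν A H)

/-- The optimal policy is an upper bound for the values, so the supremum is a genuine maximum and
not the default value of an unbounded one. -/
theorem optValue_eq (f : 𝓗) : (C.model f).optValue = (C.model f).value (C.optPolicy f) :=
  have : Nonempty (Policy O A H) := ⟨C.optPolicy f⟩
  le_antisymm (ciSup_le (C.optPolicy_optimal f))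
    (le_ciSup (f := (C.model f).value) ⟨_, Set.forall_mem_range.2 (C.optPolicy_optimal f)⟩ _)

theorem optValue_nonneg (f : 𝓗) : 0 ≤ (C.model f).optValue := by
  rw [C.optValue_eq]; exact Model.value_nonneg _ _

theorem optValue_le_one (f : 𝓗) : (C.model f).optValue ≤ 1 := by
  rw [C.optValue_eq]; exact Model.value_le_one _ _

theorem value_le_optValue (f : 𝓗) (π : Policy O A H) :
    (C.model f).value π ≤ (C.model f).optValue := by
  rw [C.optValue_eq]; exact C.optPolicy_optimal f π

theorem measurable_optValue : Measurable fun f => (C.model f).optValue := by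
  simp_rw [C.optValue_eq]
  exact measurable_family_value C.measurable_dens C.measurable_reward C.measurable_optPolicy

theorem measurable_value_optPolicy (fstar : 𝓗) :
    Measurable fun f => (C.model fstar).value (C.optPolicy f) :=
  measurable_family_value (M := fun _ => C.model fstar)
    (fun h => ((C.model fstar).measurable_dens h).comp measurable_snd)
    (fun h => ((C.model fstar).measurable_reward h).comp measurable_snd) C.measurable_optPolicy

theorem measurable_traj : Measurable fun x : 𝓗 × Traj O A H => (C.model x.1).traj x.2 :=
  measurable_family_traj C.measurable_dens

theorem measurable_expWeight (h : Fin H) :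
    Measurable fun x : 𝓗 × Traj O A H => C.expWeight x.1 h x.2 := by
  refine measurable_const.mul (Finset.measurable_sum _ fun u _ => ?_)
  refine measurable_family_weight
    (π := fun f => (C.optPolicy f).explore (C.tail f h u) h u) fun k a => ?_
  simp only [Policy.explore]
  split_ifs
  · exact C.measurable_optPolicy k a
  · exact measurable_const
  · exact measurable_const
  · exact measurable_const
  · exact C.measurable_tail h u k a

theorem measurable_expWeight_right (f : 𝓗) (h : Fin H) :
    Measurable fun τ => C.expWeight f h τ :=
  Measurable.of_uncurry_left (f := fun f τ => C.expWeight f h τ) (C.measurable_expWeight h)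

theorem coreActs_nonempty (h : Fin H) : (C.coreActs h).Nonempty := by
  rw [coreActs, Set.Finite.toFinset_nonempty]
  exact (C.tests_nonempty h).image _

theorem lintegral_traj_mul_expWeight (M : Model ν A H) (f : 𝓗) (h : Fin H) :
    ∫⁻ τ, ((M.traj τ * C.expWeight f h τ : ℝ≥0) : ℝ≥0∞) ∂(refMeasure ν A H) = 1 := by
  have hcard : ((C.coreActs h).card : ℝ≥0∞) ≠ 0 := by
    simpa using (C.coreActs_nonempty h).ne_empty
  have key : M.law (C.expWeight f h) Set.univ = 1 := by
    have := M.law_average (C.coreActs h) ((C.coreActs h).card : ℝ≥0)⁻¹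
      (w := fun u => ((C.optPolicy f).explore (C.tail f h u) h u).weight)
      fun u => Policy.measurable_weight _
    change M.law (C.expWeight f h) = _ at this
    rw [this, Measure.smul_apply, Measure.finsetSum_apply]
    simp only [measure_univ, Finset.sum_const, nsmul_eq_mul, mul_one]
    rw [ENNReal.smul_def, ENNReal.coe_inv (by simpa using (C.coreActs_nonempty h).ne_empty)]
    simpa using ENNReal.inv_mul_cancel hcard (by simp)
  rwa [Model.law, withDensity_apply _ .univ, Measure.restrict_univ] at key

instance (M : Model ν A H) (f : 𝓗) (h : Fin H) :
    IsProbabilityMeasure (M.law (C.expWeight f h)) :=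
  Model.isProbabilityMeasure_law (C.lintegral_traj_mul_expWeight M f h)

theorem trainErr_nonneg (fstar g f : 𝓗) (h : Fin H) : 0 ≤ C.trainErr fstar g f h :=
  hellingerSq_nonneg

theorem trainErr_le_one (fstar g f : 𝓗) (h : Fin H) : C.trainErr fstar g f h ≤ 1 :=
  hellingerSq_le_one (Model.measurable_traj_mul _ (C.measurable_expWeight_right f h))
    (Model.measurable_traj_mul _ (C.measurable_expWeight_right f h))
    (C.lintegral_traj_mul_expWeight _ f h) (C.lintegral_traj_mul_expWeight _ f h)

theorem measurable_trainErr (fstar : 𝓗) (h : Fin H) :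
    Measurable fun x : 𝓗 × 𝓗 => C.trainErr fstar x.1 x.2 h := by
  have hw : Measurable fun x : (𝓗 × 𝓗) × Traj O A H => C.expWeight x.1.2 h x.2 :=
    (C.measurable_expWeight h).comp (f := fun x : (𝓗 × 𝓗) × Traj O A H => (x.1.2, x.2))
      (by fun_prop)
  have hg : Measurable fun x : (𝓗 × 𝓗) × Traj O A H => (C.model x.1.1).traj x.2 :=
    C.measurable_traj.comp (f := fun x : (𝓗 × 𝓗) × Traj O A H => (x.1.1, x.2)) (by fun_prop)
  have hs : Measurable fun x : (𝓗 × 𝓗) × Traj O A H => (C.model fstar).traj x.2 :=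
    (C.model fstar).measurable_traj.comp measurable_snd
  exact measurable_const.mul (((hg.mul hw).coe_nnreal_real.sqrt.sub
    (hs.mul hw).coe_nnreal_real.sqrt).pow_const 2).stronglyMeasurable.integral_prod_right.measurable

theorem lintegral_rootRatio (fstar g f : 𝓗) (h : Fin H) :
    ∫⁻ τ, ((C.model fstar).rootRatio (C.model g) τ : ℝ≥0∞)
      ∂((C.model fstar).law (C.expWeight f h)) = ENNReal.ofReal (1 - C.trainErr fstar g f h) :=
  Model.lintegral_rootRatio _ _ (C.measurable_expWeight_right f h)
    (C.lintegral_traj_mul_expWeight _ f h) (C.lintegral_traj_mul_expWeight _ f h)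

theorem logClose_of_mem_nearby {fstar g : 𝓗} {ε : ℝ} (hε : 0 ≤ ε) (hg : g ∈ C.nearby fstar ε)
    (f : 𝓗) (h : Fin H) :
    (C.model fstar).LogClose (C.model g) (C.expWeight f h) (ε / 2) :=
  Model.LogClose.average (C.coreActs_nonempty h)
    (w := fun u => ((C.optPolicy f).explore (C.tail f h u) h u).weight)
    (fun _ => Policy.measurable_weight _)
    fun _ _ => Model.logClose_of_klDiv_le _ _ _ hε (hg.2 _)

/-- The law of the trajectories that one round collects with the exploration policies of `f`. -/
def episodes (fstar f : 𝓗) : Measure (Fin H → Traj O A H) :=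
  Measure.pi fun h => (C.model fstar).law (C.expWeight f h)

instance (fstar f : 𝓗) : IsProbabilityMeasure (C.episodes fstar f) := by
  unfold episodes; infer_instance

theorem measurable_law_expWeight (fstar : 𝓗) (h : Fin H) :
    Measurable fun f => (C.model fstar).law (C.expWeight f h) := by
  refine Measure.measurable_of_measurable_coe _ fun s hs => ?_
  simp only [Model.law, withDensity_apply _ hs]
  have : Measurable fun x : 𝓗 × Traj O A H =>
      (((C.model fstar).traj x.2 * C.expWeight x.1 h x.2 : ℝ≥0) : ℝ≥0∞) :=
    (((C.model fstar).measurable_traj.comp measurable_snd).mul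
      (C.measurable_expWeight h)).coe_nnreal_ennreal
  exact this.lintegral_prod_right'

/-- On measurable boxes the product law is a product of measurable functions of f, and boxes form a
generating π-system. -/
theorem measurable_episodes (fstar : 𝓗) : Measurable (C.episodes fstar) := by
  refine .measure_of_isPiSystem_of_isProbabilityMeasure generateFrom_pi.symm isPiSystem_pi ?_
  rintro _ ⟨s, hs, rfl⟩
  have hs' : ∀ h, MeasurableSet (s h) := fun h => hs h trivial
  simp only [episodes, Measure.pi_pi]
  exact Finset.measurable_prod _ fun h _ =>
    (Measure.measurable_coe (hs' h)).comp (C.measurable_law_expWeight fstar h)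

/-- The episodes of one round, as a kernel. -/
def episodeKernel (fstar : 𝓗) : Kernel 𝓗 (Fin H → Traj O A H) :=
  ⟨C.episodes fstar, C.measurable_episodes fstar⟩

instance (fstar : 𝓗) : IsMarkovKernel (C.episodeKernel fstar) :=
  ⟨fun f => inferInstanceAs (IsProbabilityMeasure (C.episodes fstar f))⟩

/-- Given the hypothesis of the round, its H episodes are independent. -/
theorem lintegral_episodes_prod (fstar f : 𝓗) {k : Fin H → Traj O A H → ℝ≥0∞}
    (hk : ∀ h, Measurable (k h)) :
    ∫⁻ D, ∏ h, k h (D h) ∂(C.episodes fstar f) =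
      ∏ h, ∫⁻ τ, k h τ ∂((C.model fstar).law (C.expWeight f h)) := by
  refine (lintegral_prod_eq_prod_lintegral_of_indepFun Finset.univ
    (fun h (D : Fin H → Traj O A H) => k h (D h))
    (iIndepFun_pi fun h => (hk h).aemeasurable)
    fun h => (hk h).comp (measurable_pi_apply h)).trans ?_
  exact Finset.prod_congr rfl fun h _ =>
    (measurePreserving_eval _ h).lintegral_comp (hk h)

end PSRClass

/-! ### Sequences of rounds generated by kernels -/

section IterLaw

variable {X : Type*} [MeasurableSpace X]

/-- Append a round to a sequence of rounds. -/
def snocRound {t : ℕ} (p : (Fin t → X) × X) : Fin (t + 1) → X :=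
  Fin.snoc (α := fun _ => X) p.1 p.2

theorem measurable_snocRound {t : ℕ} :
    Measurable (snocRound : (Fin t → X) × X → Fin (t + 1) → X) := by
  refine measurable_pi_lambda _ fun i => ?_
  refine Fin.lastCases ?_ (fun j => ?_) i
  · simpa [snocRound] using measurable_snd
  · simp only [snocRound, Fin.snoc_castSucc]
    exact (measurable_pi_apply j).comp measurable_fst

@[simp]
theorem snocRound_castSucc {t : ℕ} (p : (Fin t → X) × X) (s : Fin t) :
    snocRound p s.castSucc = p.1 s :=
  Fin.snoc_castSucc (α := fun _ => X) ..

@[simp]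
theorem snocRound_last {t : ℕ} (p : (Fin t → X) × X) : snocRound p (Fin.last t) = p.2 :=
  Fin.snoc_last (α := fun _ => X) ..

/-- The law of the first `t` rounds when round `t` is drawn from `κ t` given the past. -/
def iterLaw (κ : ∀ t, Kernel (Fin t → X) X) : (t : ℕ) → Measure (Fin t → X)
  | 0 => Measure.dirac fun i => i.elim0
  | t + 1 => (iterLaw κ t ⊗ₘ κ t).map snocRound

variable {κ : ∀ t, Kernel (Fin t → X) X} [∀ t, IsFiniteKernel (κ t)]

instance instIsFiniteMeasureIterLaw : ∀ t, IsFiniteMeasure (iterLaw κ t)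
  | 0 => by unfold iterLaw; infer_instance
  | t + 1 => by
    have := instIsFiniteMeasureIterLaw t
    unfold iterLaw
    infer_instance

theorem lintegral_iterLaw_succ {t : ℕ} {F : (Fin (t + 1) → X) → ℝ≥0∞} (hF : Measurable F) :
    ∫⁻ run, F run ∂(iterLaw κ (t + 1)) =
      ∫⁻ past, ∫⁻ x, F (snocRound (past, x)) ∂(κ t past) ∂(iterLaw κ t) := by
  rw [iterLaw, lintegral_map hF measurable_snocRound,
    Measure.lintegral_compProd (f := fun p => F (snocRound p)) (hF.comp measurable_snocRound)]

theorem integrable_iterLaw_succ {t : ℕ} {F : (Fin (t + 1) → X) → ℝ} (hF : Measurable F) :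
    Integrable F (iterLaw κ (t + 1)) ↔
      Integrable (fun p => F (snocRound p)) (iterLaw κ t ⊗ₘ κ t) :=
  integrable_map_measure hF.aestronglyMeasurable measurable_snocRound.aemeasurable

theorem ae_iterLaw {p : X → Prop} (hp : MeasurableSet {x | p x})
    (h : ∀ t past, ∀ᵐ x ∂(κ t past), p x) :
    ∀ t, ∀ᵐ run ∂(iterLaw κ t), ∀ s, p (run s)
  | 0 => .of_forall fun _ s => s.elim0
  | t + 1 => by
    have hm : MeasurableSet {run : Fin (t + 1) → X | ∀ s, p (run s)} := by
      rw [Set.ofPred_forall]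
      exact MeasurableSet.iInter fun s => measurable_pi_apply s hp
    rw [iterLaw, ae_map_iff measurable_snocRound.aemeasurable hm]
    refine Measure.ae_compProd_of_ae_ae (measurable_snocRound hm) ?_
    filter_upwards [ae_iterLaw hp h t] with past h1
    filter_upwards [h t past] with x h2 s
    refine Fin.lastCases ?_ (fun j => ?_) s
    · simpa using h2
    · simpa using h1 j

/-- The supermartingale argument: given the past, the last factor has mean at most 1, and it is
integrated out first. Kernels of mass below 1 do no harm here. -/
theorem lintegral_prod_iterLaw_le_one {k : X → ℝ≥0∞} (hk : Measurable k)
    (h : ∀ t past, ∫⁻ x, k x ∂(κ t past) ≤ 1) :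
    ∀ t, ∫⁻ run, ∏ s, k (run s) ∂(iterLaw κ t) ≤ 1
  | 0 => by simp [iterLaw]
  | t + 1 => by
    have hm : Measurable fun run : Fin (t + 1) → X => ∏ s, k (run s) :=
      Finset.measurable_prod _ fun s _ => hk.comp (measurable_pi_apply s)
    rw [lintegral_iterLaw_succ hm]
    refine le_trans (lintegral_mono fun past => ?_) (lintegral_prod_iterLaw_le_one hk h t)
    simp only [Fin.prod_univ_castSucc, snocRound_castSucc, snocRound_last]
    rw [lintegral_const_mul _ hk]
    exact mul_le_of_le_one_right' (h t past)

theorem isProbabilityMeasure_iterLaw_succ {t : ℕ} (h : IsProbabilityMeasure (iterLaw κ t))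
    (hκ : ∀ᵐ past ∂(iterLaw κ t), κ t past Set.univ = 1) :
    IsProbabilityMeasure (iterLaw κ (t + 1)) := by
  constructor
  have := lintegral_iterLaw_succ (κ := κ) (t := t) (F := fun _ => 1) measurable_const
  simp only [lintegral_const, one_mul] at this
  rw [this, lintegral_congr_ae hκ, lintegral_const, measure_univ, one_mul]

theorem integrable_compProd_fst {t : ℕ} (hκ : ∀ᵐ past ∂(iterLaw κ t), κ t past Set.univ = 1)
    {S : (Fin t → X) → ℝ} (hS : Measurable S) (hi : Integrable S (iterLaw κ t)) :
    Integrable (fun p => S p.1) (iterLaw κ t ⊗ₘ κ t) := by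
  rw [Measure.integrable_compProd_iff (f := fun p => S p.1)
    (hS.comp measurable_fst).aestronglyMeasurable]
  refine ⟨.of_forall fun past =>
    (integrable_const (S past) : Integrable (fun _ => S past) (κ t past)), hi.norm.congr ?_⟩
  filter_upwards [hκ] with past h
  simp [measureReal_def, h]

theorem integrable_compProd_snd {t : ℕ} {k : X → ℝ} (hk : Measurable k) {c : ℝ≥0∞} (hc : c ≠ ∞)
    (h : ∀ past, ∫⁻ x, ‖k x‖ₑ ∂(κ t past) ≤ c) :
    Integrable (fun p => k p.2) (iterLaw κ t ⊗ₘ κ t) := by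
  refine ⟨(hk.comp measurable_snd).aestronglyMeasurable, ?_⟩
  rw [hasFiniteIntegral_iff_enorm, Measure.lintegral_compProd
    (f := fun p : (Fin t → X) × X => ‖k p.2‖ₑ) (hk.comp measurable_snd).enorm]
  refine (lintegral_mono fun past => h past).trans_lt ?_
  rw [lintegral_const]
  exact ENNReal.mul_lt_top hc.lt_top (measure_lt_top _ _)

/-- The additive counterpart. The constant `c₁` serves integrability only. Almost sure mass one is
needed because appending a round must not rescale the sum over the earlier rounds. -/
theorem integral_sum_iterLaw_le {k : X → ℝ} (hk : Measurable k) {c₁ : ℝ≥0∞} (hc₁ : c₁ ≠ ∞) {c : ℝ}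
    (h₁ : ∀ t past, ∫⁻ x, ‖k x‖ₑ ∂(κ t past) ≤ c₁) (h : ∀ t past, ∫ x, k x ∂(κ t past) ≤ c) :
    ∀ t, (∀ s ≤ t, IsProbabilityMeasure (iterLaw κ s)) →
      (∀ s < t, ∀ᵐ past ∂(iterLaw κ s), κ s past Set.univ = 1) →
      Integrable (fun run => ∑ s, k (run s)) (iterLaw κ t) ∧
        ∫ run, ∑ s, k (run s) ∂(iterLaw κ t) ≤ t * c
  | 0, _, _ => by simp [iterLaw]
  | t + 1, hp, hκ => by
    obtain ⟨hi, hle⟩ := integral_sum_iterLaw_le hk hc₁ h₁ h t (fun s hs => hp s (by omega))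
      fun s hs => hκ s (by omega)
    have hpt := hp t (by omega)
    have hκt := hκ t (by omega)
    have hmS : ∀ t, Measurable fun run : Fin t → X => ∑ s, k (run s) := fun t =>
      Finset.measurable_sum _ fun s _ => hk.comp (measurable_pi_apply s)
    have hif := integrable_compProd_fst hκt (hmS t) hi
    have his := integrable_compProd_snd (t := t) hk hc₁ (h₁ t)
    have hsum : ∀ p : (Fin t → X) × X, ∑ s, k (snocRound p s) = ∑ s, k (p.1 s) + k p.2 := by
      intro p
      simp [Fin.sum_univ_castSucc]
    have hii : Integrable (fun p => ∑ s, k (snocRound p s)) (iterLaw κ t ⊗ₘ κ t) := by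
      simp_rw [hsum]; exact hif.add his
    refine ⟨(integrable_iterLaw_succ (hmS _)).2 hii, ?_⟩
    have hg : Integrable (fun past => ∫ x, k x ∂(κ t past)) (iterLaw κ t) := by
      have his' := his
      rw [Measure.compProd] at his'
      simpa using his'.integral_compProd
    rw [iterLaw, integral_map measurable_snocRound.aemeasurable (hmS _).aestronglyMeasurable]
    simp_rw [hsum]
    rw [integral_add hif his, Measure.integral_compProd hif, Measure.integral_compProd his]
    have e1 : ∫ past, ∫ _, ∑ s, k (past s) ∂(κ t past) ∂(iterLaw κ t) =
        ∫ past, ∑ s, k (past s) ∂(iterLaw κ t) := by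
      refine integral_congr_ae ?_
      filter_upwards [hκt] with past h
      simp [measureReal_def, h]
    have e2 : ∫ past, ∫ x, k x ∂(κ t past) ∂(iterLaw κ t) ≤ c := by
      refine (integral_mono hg (integrable_const c) fun past => h t past).trans ?_
      simp
    push_cast
    linarith

end IterLaw

/-! ### The algorithm as a sequence of kernels -/

namespace PSRClass

variable {𝓗 O A : Type*} [MeasurableSpace 𝓗] [MeasurableSpace O] [MeasurableSpace A]
  [DiscreteMeasurableSpace A] [Fintype A] [Nonempty A] {ν : Measure O} [SigmaFinite ν] {H : ℕ}
  (C : PSRClass 𝓗 ν A H) (fstar : 𝓗) (p₀ : Measure 𝓗) [IsProbabilityMeasure p₀] (η γ : ℝ)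

theorem measurable_postWeight (t : ℕ) :
    Measurable fun x : (Fin t → Fin H → Traj O A H) × 𝓗 => C.postWeight η γ x.1 x.2 := by
  refine Measurable.mul ?_ ?_
  · exact (((C.measurable_optValue.comp measurable_snd).const_mul γ).exp).ennreal_ofReal
  · refine Finset.measurable_prod _ fun s _ => Finset.measurable_prod _ fun h _ => ?_
    refine Measurable.coe_nnreal_ennreal (Measurable.pow_const ?_ η)
    exact C.measurable_traj.comp
      (f := fun x : (Fin t → Fin H → Traj O A H) × 𝓗 => (x.2, x.1 s h)) (by fun_prop)

/-- The normalizing constant of the posterior. -/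
def evidence {t : ℕ} (D : Fin t → Fin H → Traj O A H) : ℝ≥0∞ :=
  ∫⁻ f, C.postWeight η γ D f ∂p₀

theorem measurable_evidence (t : ℕ) :
    Measurable fun D : Fin t → Fin H → Traj O A H => C.evidence p₀ η γ D :=
  (C.measurable_postWeight η γ t).lintegral_prod_right'

/-- The trajectories of a sequence of rounds. -/
def data {t : ℕ} (past : Fin t → 𝓗 × (Fin H → Traj O A H)) : Fin t → Fin H → Traj O A H :=
  fun s => (past s).2

theorem measurable_data (t : ℕ) :
    Measurable (data : (Fin t → 𝓗 × (Fin H → Traj O A H)) → Fin t → Fin H → Traj O A H) :=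
  measurable_pi_lambda _ fun s => measurable_snd.comp (measurable_pi_apply s)

theorem measurable_postWeight_past (t : ℕ) :
    Measurable fun x : (Fin t → 𝓗 × (Fin H → Traj O A H)) × 𝓗 =>
      C.postWeight η γ (data x.1) x.2 :=
  (C.measurable_postWeight η γ t).comp
    (f := fun x : (Fin t → 𝓗 × (Fin H → Traj O A H)) × 𝓗 => (data x.1, x.2))
    (((measurable_data t).comp measurable_fst).prodMk measurable_snd)

/-- The density of the posterior with respect to the prior. -/
def postDensity {t : ℕ} (past : Fin t → 𝓗 × (Fin H → Traj O A H)) (f : 𝓗) : ℝ≥0∞ :=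
  (C.evidence p₀ η γ (data past))⁻¹ * C.postWeight η γ (data past) f

theorem measurable_postDensity (t : ℕ) :
    Measurable (Function.uncurry (C.postDensity p₀ η γ (t := t))) :=
  (((C.measurable_evidence p₀ η γ t).comp (measurable_data t)).comp measurable_fst).inv.mul
    (C.measurable_postWeight_past η γ t)

/-- The posterior, as a kernel. -/
def posteriorKernel (t : ℕ) : Kernel (Fin t → 𝓗 × (Fin H → Traj O A H)) 𝓗 :=
  (Kernel.const _ p₀).withDensity (C.postDensity p₀ η γ)

theorem posteriorKernel_apply' {t : ℕ} (past : Fin t → 𝓗 × (Fin H → Traj O A H)) :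
    C.posteriorKernel p₀ η γ t past = p₀.withDensity (C.postDensity p₀ η γ past) := by
  rw [posteriorKernel, Kernel.withDensity_apply _ (C.measurable_postDensity p₀ η γ t),
    Kernel.const_apply]

theorem posteriorKernel_apply {t : ℕ} (past : Fin t → 𝓗 × (Fin H → Traj O A H)) :
    C.posteriorKernel p₀ η γ t past = C.posterior p₀ η γ fun s => (past s).2 := by
  rw [posteriorKernel_apply', posterior, ← withDensity_smul]
  · rfl
  · exact (C.measurable_postWeight_past η γ t).of_uncurry_left
      (f := fun past f => C.postWeight η γ (data past) f)

theorem posteriorKernel_univ {t : ℕ} (past : Fin t → 𝓗 × (Fin H → Traj O A H)) :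
    C.posteriorKernel p₀ η γ t past Set.univ =
      (C.evidence p₀ η γ (data past))⁻¹ * C.evidence p₀ η γ (data past) := by
  rw [posteriorKernel_apply, posterior, Measure.smul_apply, withDensity_apply _ .univ,
    Measure.restrict_univ]
  rfl

/-- If the evidence is 0 or ∞, the conventions for inverses make the posterior the zero measure. It
is therefore a finite kernel for every past, before it is known to be almost surely a probability
measure. -/
theorem posteriorKernel_univ_le {t : ℕ} (past : Fin t → 𝓗 × (Fin H → Traj O A H)) :
    C.posteriorKernel p₀ η γ t past Set.univ ≤ 1 := by
  rw [posteriorKernel_univ]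
  exact ENNReal.inv_mul_le_one _

instance (t : ℕ) : IsFiniteKernel (C.posteriorKernel p₀ η γ t) :=
  ⟨⟨1, ENNReal.one_lt_top, C.posteriorKernel_univ_le p₀ η γ⟩⟩

/-- One round of the algorithm, as a kernel. -/
def roundKernel (t : ℕ) :
    Kernel (Fin t → 𝓗 × (Fin H → Traj O A H)) (𝓗 × (Fin H → Traj O A H)) :=
  C.posteriorKernel p₀ η γ t ⊗ₖ (C.episodeKernel fstar).prodMkLeft _

instance (t : ℕ) : IsFiniteKernel (C.roundKernel fstar p₀ η γ t) := by
  unfold roundKernel; infer_instance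

theorem lintegral_roundKernel {t : ℕ} (past : Fin t → 𝓗 × (Fin H → Traj O A H))
    {F : 𝓗 × (Fin H → Traj O A H) → ℝ≥0∞} (hF : Measurable F) :
    ∫⁻ x, F x ∂(C.roundKernel fstar p₀ η γ t past) =
      ∫⁻ f, ∫⁻ D, F (f, D) ∂(C.episodes fstar f) ∂(C.posteriorKernel p₀ η γ t past) := by
  rw [roundKernel, Kernel.lintegral_compProd _ _ _ hF]
  rfl

theorem roundKernel_univ {t : ℕ} (past : Fin t → 𝓗 × (Fin H → Traj O A H)) :
    C.roundKernel fstar p₀ η γ t past Set.univ = C.posteriorKernel p₀ η γ t past Set.univ := by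
  rw [← lintegral_one, lintegral_roundKernel _ _ _ _ _ _ measurable_const]
  simp

/-- The iterated `bind` is the composition of the kernels of the rounds. Most of the work is the
measurability of the maps inside `bind`, without which `bind` has no useful formula. -/
theorem runLaw_eq_iterLaw :
    ∀ t, C.runLaw fstar p₀ η γ t = iterLaw (C.roundKernel fstar p₀ η γ) t
  | 0 => rfl
  | t + 1 => by
    have hround : ∀ past : Fin t → 𝓗 × (Fin H → Traj O A H),
        ((C.posterior p₀ η γ fun s => (past s).2).bind fun f =>
          (Measure.pi fun h => (C.model fstar).law (C.expWeight f h)).map fun D =>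
            Fin.snoc (α := fun _ => 𝓗 × (Fin H → Traj O A H)) past (f, D)) =
        (C.roundKernel fstar p₀ η γ t past).map fun x => snocRound (past, x) := by
      intro past
      have hs : Measurable fun x : 𝓗 × (Fin H → Traj O A H) => snocRound (past, x) :=
        measurable_snocRound.comp measurable_prodMk_left
      have hs' : ∀ f, Measurable fun D : Fin H → Traj O A H => snocRound (past, (f, D)) :=
        fun f => hs.comp measurable_prodMk_left
      have hmeas : ∀ S, MeasurableSet S → ∀ f,
          ((C.episodes fstar f).map fun D => snocRound (past, (f, D))) S =
            C.episodeKernel fstar f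
              (Prod.mk f ⁻¹' ((fun x => snocRound (past, x)) ⁻¹' S)) := by
        intro S hS f
        rw [Measure.map_apply (hs' f) hS]
        rfl
      have hG : Measurable fun f => (C.episodes fstar f).map fun D => snocRound (past, (f, D)) := by
        refine Measure.measurable_of_measurable_coe _ fun S hS => ?_
        simp_rw [hmeas S hS]
        exact Kernel.measurable_kernel_prodMk_left (hs hS)
      ext S hS
      rw [Measure.map_apply hs hS, roundKernel, Kernel.compProd_apply (hs hS),
        posteriorKernel_apply]
      refine (Measure.bind_apply hS hG.aemeasurable).trans (lintegral_congr fun f => ?_)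
      exact hmeas S hS f
    rw [runLaw, iterLaw, ← runLaw_eq_iterLaw t]
    simp_rw [hround]
    have hmeas : ∀ S, MeasurableSet S → ∀ past : Fin t → 𝓗 × (Fin H → Traj O A H),
        ((C.roundKernel fstar p₀ η γ t past).map fun x => snocRound (past, x)) S =
          C.roundKernel fstar p₀ η γ t past (Prod.mk past ⁻¹' (snocRound ⁻¹' S)) := by
      intro S hS past
      have hs : Measurable fun x : 𝓗 × (Fin H → Traj O A H) => snocRound (past, x) :=
        measurable_snocRound.comp measurable_prodMk_left
      rw [Measure.map_apply hs hS]
      rfl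
    have hG : Measurable fun past : Fin t → 𝓗 × (Fin H → Traj O A H) =>
        (C.roundKernel fstar p₀ η γ t past).map fun x => snocRound (past, x) := by
      refine Measure.measurable_of_measurable_coe _ fun S hS => ?_
      simp_rw [hmeas S hS]
      exact Kernel.measurable_kernel_prodMk_left (measurable_snocRound hS)
    have : SFinite (C.runLaw fstar p₀ η γ t) := by
      rw [runLaw_eq_iterLaw t]; infer_instance
    ext S hS
    rw [Measure.bind_apply hS hG.aemeasurable, Measure.map_apply measurable_snocRound hS,
      Measure.compProd_apply (measurable_snocRound hS)]
    exact lintegral_congr fun past => hmeas S hS past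

end PSRClass

/-! ### Change of measure from the posterior to a part of the prior -/

section ChangeOfMeasure

variable {Ω 𝓗 : Type*} [MeasurableSpace Ω] [MeasurableSpace 𝓗]

/-- A change of measure: if `exp g` times the mean of `w` under the prior has a small expectation,
then the expectation of `g` is bounded by the logarithmic loss of any part of the prior. -/
theorem integral_le_of_exp_mul_lintegral_le {P : Measure Ω} [IsProbabilityMeasure P]
    {p₀ : Measure 𝓗} [IsProbabilityMeasure p₀] {w : Ω → 𝓗 → ℝ≥0}
    (hw : Measurable (Function.uncurry w)) {g : Ω → ℝ} (hg : Measurable g) (hgi : Integrable g P)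
    {Y : Ω → ℝ≥0∞} {y : ℝ} (hy : 0 ≤ y) (hY : ∫⁻ ω, Y ω ∂P ≤ ENNReal.ofReal y)
    (hgY : ∀ᵐ ω ∂P, ENNReal.ofReal (Real.exp (g ω)) * ∫⁻ f, w ω f ∂p₀ ≤ Y ω)
    {B : Set 𝓗} (hB : p₀ B ≠ 0) {c : ℝ} (hpos : ∀ f ∈ B, ∀ᵐ ω ∂P, 0 < w ω f)
    (hint : ∀ f ∈ B, Integrable (fun ω => Real.log (w ω f)) P)
    (hle : ∀ f ∈ B, ∫ ω, -Real.log (w ω f) ∂P ≤ c) :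
    ∫ ω, g ω ∂P ≤ c - Real.log (p₀ B).toReal + y - 1 := by
  set b := (p₀ B).toReal with hb
  have hb0 : 0 < b := ENNReal.toReal_pos hB (measure_ne_top _ _)
  have hbB : p₀ B = ENNReal.ofReal b := by rw [hb, ENNReal.ofReal_toReal (measure_ne_top _ _)]
  -- The claim is K ≤ y. For f in `B`, e^x ≥ 1 + x with x = g + log b + log w gives F f ≥ K. On the
  -- other hand, the prior mean of F is at most b y, and `B` has mass b. Taking expectations for
  -- each f separately avoids the logarithm of the prior mean of w and its integrability.
  set K : ℝ := 1 + ∫ ω, g ω ∂P + Real.log b - c with hK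
  let F : 𝓗 → ℝ≥0∞ := fun f => ∫⁻ ω, ENNReal.ofReal (Real.exp (g ω + Real.log b)) * w ω f ∂P
  have hmF : Measurable fun x : Ω × 𝓗 =>
      ENNReal.ofReal (Real.exp (g x.1 + Real.log b)) * (w x.1 x.2 : ℝ≥0∞) :=
    (((hg.comp measurable_fst).add_const _).exp.ennreal_ofReal).mul hw.coe_nnreal_ennreal
  have hFm : Measurable F := hmF.lintegral_prod_left'
  have hFK : ∀ f ∈ B, ENNReal.ofReal K ≤ F f := by
    intro f hf
    have hi : Integrable (fun ω => 1 + g ω + Real.log b + Real.log (w ω f)) P :=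
      (((integrable_const 1).add hgi).add (integrable_const _)).add (hint f hf)
    have h1 : K ≤ ∫ ω, (1 + g ω + Real.log b + Real.log (w ω f)) ∂P := by
      have e1 := integral_add (((integrable_const (μ := P) (1 : ℝ)).add hgi).add
        (integrable_const (Real.log b))) (hint f hf)
      have e2 := integral_add ((integrable_const (μ := P) (1 : ℝ)).add hgi)
        (integrable_const (Real.log b))
      have e3 := integral_add (integrable_const (μ := P) (1 : ℝ)) hgi
      simp only [Pi.add_apply, integral_const, probReal_univ, smul_eq_mul, mul_one] at e1 e2 e3
      have e4 := hle f hf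
      rw [integral_neg] at e4
      rw [e1, e2, e3]
      linarith
    -- Passing to the positive part allows the comparison with a lower Lebesgue integral.
    refine (ENNReal.ofReal_le_ofReal (h1.trans (integral_mono_ae hi hi.pos_part ?_))).trans ?_
    · exact .of_forall fun ω => le_max_left _ _
    rw [ofReal_integral_eq_lintegral_ofReal hi.pos_part (.of_forall fun ω => le_max_right _ _)]
    refine lintegral_mono_ae ?_
    filter_upwards [hpos f hf] with ω hω
    rw [← ENNReal.ofReal_coe_nnreal, ← ENNReal.ofReal_mul (Real.exp_pos _).le]
    refine ENNReal.ofReal_le_ofReal (max_le ?_ (by positivity))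
    have hω' : (0 : ℝ) < w ω f := by exact_mod_cast hω
    rw [← Real.exp_log hω', ← Real.exp_add, Real.log_exp]
    linarith [Real.add_one_le_exp (g ω + Real.log b + Real.log (w ω f))]
  have hswap : ∫⁻ f, F f ∂p₀ ≤ ENNReal.ofReal b * ENNReal.ofReal y := by
    rw [lintegral_lintegral_swap
      (f := fun f ω => ENNReal.ofReal (Real.exp (g ω + Real.log b)) * (w ω f : ℝ≥0∞))
      (hmF.comp measurable_swap).aemeasurable]
    calc _ ≤ ∫⁻ ω, ENNReal.ofReal b * Y ω ∂P := by
          refine lintegral_mono_ae ?_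
          filter_upwards [hgY] with ω hω
          rw [lintegral_const_mul _ (hw.of_uncurry_left (f := w)).coe_nnreal_ennreal, Real.exp_add,
            Real.exp_log hb0, mul_comm (Real.exp _), ENNReal.ofReal_mul hb0.le, mul_assoc]
          gcongr
      _ = ENNReal.ofReal b * ∫⁻ ω, Y ω ∂P := lintegral_const_mul' _ _ ENNReal.ofReal_ne_top
      _ ≤ _ := by gcongr
  -- Markov's inequality is applied to the measurable superset {K ≤ F} of `B`, so `B` itself need
  -- not be measurable. This matters for `nearby`, which is defined through all policies at once.
  have hmk : ENNReal.ofReal K * p₀ B ≤ ENNReal.ofReal b * ENNReal.ofReal y :=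
    calc ENNReal.ofReal K * p₀ B ≤ ENNReal.ofReal K * p₀ {f | ENNReal.ofReal K ≤ F f} := by
          gcongr; exact hFK
      _ ≤ _ := mul_meas_ge_le_lintegral hFm _
      _ ≤ _ := hswap
  rw [hbB, mul_comm, ENNReal.mul_le_mul_iff_right (by simpa using hb0) ENNReal.ofReal_ne_top,
    ENNReal.ofReal_le_ofReal_iff hy] at hmk
  linarith

end ChangeOfMeasure

/-! ### Likelihood ratios along a run -/

namespace PSRClass

variable {𝓗 O A : Type*} [MeasurableSpace 𝓗] [MeasurableSpace O] [MeasurableSpace A]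
  [DiscreteMeasurableSpace A] [Fintype A] [Nonempty A] {ν : Measure O} [SigmaFinite ν] {H : ℕ}
  (C : PSRClass 𝓗 ν A H) (fstar : 𝓗) (p₀ : Measure 𝓗) [IsProbabilityMeasure p₀] (η γ : ℝ)

theorem ae_roundKernel {t : ℕ} (past : Fin t → 𝓗 × (Fin H → Traj O A H))
    {p : 𝓗 × (Fin H → Traj O A H) → Prop} (hp : MeasurableSet {x | p x})
    (h : ∀ f, ∀ᵐ D ∂(C.episodes fstar f), p (f, D)) :
    ∀ᵐ x ∂(C.roundKernel fstar p₀ η γ t past), p x := by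
  have hm : MeasurableSet {x | ¬p x} := hp.compl
  rw [ae_iff, ← lintegral_indicator_one hm,
    lintegral_roundKernel _ _ _ _ _ _ (measurable_one.indicator hm),
    lintegral_eq_zero_of_ae_eq_zero]
  refine .of_forall fun f => ?_
  refine lintegral_eq_zero_of_ae_eq_zero ?_
  filter_upwards [h f] with D hD
  simp [hD]

theorem measurePreserving_episodes (f : 𝓗) (h : Fin H) :
    MeasurePreserving (fun D : Fin H → Traj O A H => D h) (C.episodes fstar f)
      ((C.model fstar).law (C.expWeight f h)) :=
  measurePreserving_eval _ h

theorem ae_iterLaw_episodes {p : Traj O A H → Prop} (hp : MeasurableSet {x | p x})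
    (h : ∀ f h, ∀ᵐ τ ∂((C.model fstar).law (C.expWeight f h)), p τ) (t : ℕ) :
    ∀ᵐ past ∂(iterLaw (C.roundKernel fstar p₀ η γ) t), ∀ s h, p ((past s).2 h) := by
  have hm : MeasurableSet {x : 𝓗 × (Fin H → Traj O A H) | ∀ h, p (x.2 h)} := by
    rw [Set.ofPred_forall]
    exact MeasurableSet.iInter fun i => ((measurable_pi_apply i).comp measurable_snd) hp
  refine ae_iterLaw (p := fun x : 𝓗 × (Fin H → Traj O A H) => ∀ h, p (x.2 h)) hm
    (fun t past => C.ae_roundKernel fstar p₀ η γ past hm fun f => ?_) t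
  rw [ae_all_iff]
  exact fun i => (C.measurePreserving_episodes fstar f i).quasiMeasurePreserving.ae (h f i)

theorem lintegral_roundKernel_le {t : ℕ} (past : Fin t → 𝓗 × (Fin H → Traj O A H))
    {F : 𝓗 × (Fin H → Traj O A H) → ℝ≥0∞} (hF : Measurable F) {c : ℝ≥0∞}
    (h : ∀ f, ∫⁻ D, F (f, D) ∂(C.episodes fstar f) ≤ c) :
    ∫⁻ x, F x ∂(C.roundKernel fstar p₀ η γ t past) ≤ c := by
  rw [lintegral_roundKernel _ _ _ _ _ _ hF]
  refine (lintegral_mono h).trans ?_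
  rw [lintegral_const]
  exact mul_le_of_le_one_right' (C.posteriorKernel_univ_le p₀ η γ past)

theorem integral_roundKernel_le {t : ℕ} (past : Fin t → 𝓗 × (Fin H → Traj O A H))
    {F : 𝓗 × (Fin H → Traj O A H) → ℝ}
    (hi : Integrable F (C.roundKernel fstar p₀ η γ t past)) {c : ℝ} (hc : 0 ≤ c)
    (h : ∀ f, ∫ D, F (f, D) ∂(C.episodes fstar f) ≤ c) :
    ∫ x, F x ∂(C.roundKernel fstar p₀ η γ t past) ≤ c := by
  rw [roundKernel] at hi ⊢
  rw [ProbabilityTheory.integral_compProd hi]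
  refine (integral_mono hi.integral_compProd (integrable_const c) h).trans ?_
  rw [integral_const, smul_eq_mul]
  -- The posterior may have mass below 1, which preserves the bound only because c ≥ 0.
  refine mul_le_of_le_one_left hc ?_
  exact ENNReal.toReal_le_of_le_ofReal zero_le_one
    (by simpa using C.posteriorKernel_univ_le p₀ η γ past)

/-- The square root of the likelihood ratio of `f` and `fstar` on the data of past rounds. -/
def rootLik {t : ℕ} (past : Fin t → 𝓗 × (Fin H → Traj O A H)) (f : 𝓗) : ℝ≥0 :=
  ∏ s, ∏ h, (C.model fstar).rootRatio (C.model f) ((past s).2 h)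

/-- The training error of `f` on past rounds. -/
def pastErr {t : ℕ} (past : Fin t → 𝓗 × (Fin H → Traj O A H)) (f : 𝓗) : ℝ :=
  ∑ s, ∑ h, C.trainErr fstar f (past s).1 h

theorem measurable_rootRatio :
    Measurable fun x : 𝓗 × Traj O A H => (C.model fstar).rootRatio (C.model x.1) x.2 :=
  NNReal.continuous_sqrt.measurable.comp
    (C.measurable_traj.div ((C.model fstar).measurable_traj.comp measurable_snd))

theorem measurable_rootLik (t : ℕ) :
    Measurable fun x : (Fin t → 𝓗 × (Fin H → Traj O A H)) × 𝓗 => C.rootLik fstar x.1 x.2 :=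
  Finset.measurable_prod _ fun s _ => Finset.measurable_prod _ fun h _ =>
    (C.measurable_rootRatio fstar).comp
      (f := fun x : (Fin t → 𝓗 × (Fin H → Traj O A H)) × 𝓗 => (x.2, (x.1 s).2 h)) (by fun_prop)

theorem measurable_pastErr (t : ℕ) :
    Measurable fun x : (Fin t → 𝓗 × (Fin H → Traj O A H)) × 𝓗 => C.pastErr fstar x.1 x.2 :=
  Finset.measurable_sum _ fun s _ => Finset.measurable_sum _ fun h _ =>
    (C.measurable_trainErr fstar h).comp
      (f := fun x : (Fin t → 𝓗 × (Fin H → Traj O A H)) × 𝓗 => (x.2, (x.1 s).1)) (by fun_prop)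

theorem pastErr_nonneg {t : ℕ} (past : Fin t → 𝓗 × (Fin H → Traj O A H)) (f : 𝓗) :
    0 ≤ C.pastErr fstar past f :=
  Finset.sum_nonneg fun _ _ => Finset.sum_nonneg fun _ _ => C.trainErr_nonneg _ _ _ _

theorem pastErr_le {t : ℕ} (past : Fin t → 𝓗 × (Fin H → Traj O A H)) (f : 𝓗) :
    C.pastErr fstar past f ≤ t * H := by
  refine (Finset.sum_le_sum fun s _ => Finset.sum_le_sum fun h _ =>
    C.trainErr_le_one fstar f (past s).1 h).trans ?_
  simp

/-- For a fixed f, a round with exploration policies of f' contributes a factor of conditional mean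
∏ (1 - D²) exp(D²) ≤ 1, whatever f' is. How f' is chosen is irrelevant, so η and γ are arbitrary. -/
theorem lintegral_rootLik_mul_exp_le (t : ℕ) (f : 𝓗) :
    ∫⁻ past, C.rootLik fstar past f * ENNReal.ofReal (Real.exp (C.pastErr fstar past f))
      ∂(iterLaw (C.roundKernel fstar p₀ η γ) t) ≤ 1 := by
  let k : 𝓗 × (Fin H → Traj O A H) → ℝ≥0∞ := fun x =>
    (∏ h, ((C.model fstar).rootRatio (C.model f) (x.2 h) : ℝ≥0∞)) *
      ENNReal.ofReal (Real.exp (∑ h, C.trainErr fstar f x.1 h))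
  have hk : Measurable k := by
    refine Measurable.mul (Finset.measurable_prod _ fun h _ => ?_) ?_
    · exact ((Model.measurable_rootRatio _ _).comp
        ((measurable_pi_apply h).comp measurable_snd)).coe_nnreal_ennreal
    · refine (Finset.measurable_sum _ fun h _ => ?_).exp.ennreal_ofReal
      exact (C.measurable_trainErr fstar h).comp
        (f := fun x : 𝓗 × (Fin H → Traj O A H) => (f, x.1)) (by fun_prop)
  refine le_trans (le_of_eq (lintegral_congr fun past => ?_))
    (lintegral_prod_iterLaw_le_one hk (fun t past =>
      C.lintegral_roundKernel_le fstar p₀ η γ past hk fun f' => ?_) t)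
  · simp only [k, Finset.prod_mul_distrib, rootLik, pastErr, Real.exp_sum]
    rw [ENNReal.ofReal_prod_of_nonneg fun s _ => by positivity]
    push_cast
    rfl
  · have hm : ∀ h : Fin H, Measurable fun τ : Traj O A H =>
        ((C.model fstar).rootRatio (C.model f) τ : ℝ≥0∞) := fun h =>
      (Model.measurable_rootRatio _ _).coe_nnreal_ennreal
    simp only [k]
    have hm' : Measurable fun D : Fin H → Traj O A H =>
        ∏ h, ((C.model fstar).rootRatio (C.model f) (D h) : ℝ≥0∞) :=
      Finset.measurable_prod _ fun h _ => (hm h).comp (measurable_pi_apply h)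
    rw [lintegral_mul_const _ hm',
      C.lintegral_episodes_prod fstar f' hm]
    simp only [C.lintegral_rootRatio]
    rw [Real.exp_sum, ENNReal.ofReal_prod_of_nonneg fun h _ => by positivity,
      ← Finset.prod_mul_distrib]
    refine Finset.prod_le_one' fun h _ => ?_
    have he := C.trainErr_le_one fstar f f' h
    rw [← ENNReal.ofReal_mul (by linarith), ← ENNReal.ofReal_one]
    refine ENNReal.ofReal_le_ofReal ?_
    calc (1 - C.trainErr fstar f f' h) * Real.exp (C.trainErr fstar f f' h)
        ≤ Real.exp (-C.trainErr fstar f f' h) * Real.exp (C.trainErr fstar f f' h) := by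
          gcongr
          linarith [Real.add_one_le_exp (-C.trainErr fstar f f' h)]
      _ = 1 := by rw [← Real.exp_add]; simp

theorem lintegral_lintegral_rootLik_le (t : ℕ) :
    ∫⁻ past, ∫⁻ f, C.rootLik fstar past f * ENNReal.ofReal (Real.exp (C.pastErr fstar past f)) ∂p₀
      ∂(iterLaw (C.roundKernel fstar p₀ η γ) t) ≤ 1 := by
  rw [lintegral_lintegral_swap
    (f := fun past f => C.rootLik fstar past f *
      ENNReal.ofReal (Real.exp (C.pastErr fstar past f)))
    ((C.measurable_rootLik fstar t).coe_nnreal_ennreal.mul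
      (C.measurable_pastErr fstar t).exp.ennreal_ofReal).aemeasurable]
  refine (lintegral_mono fun f => C.lintegral_rootLik_mul_exp_le fstar p₀ η γ t f).trans ?_
  simp

theorem ae_iterLaw_traj_pos (t : ℕ) :
    ∀ᵐ past ∂(iterLaw (C.roundKernel fstar p₀ η γ) t),
      ∀ s h, 0 < (C.model fstar).traj ((past s).2 h) :=
  C.ae_iterLaw_episodes fstar p₀ η γ (p := fun τ => 0 < (C.model fstar).traj τ)
    (measurableSet_lt measurable_const (C.model fstar).measurable_traj)
    (fun f h => Model.ae_traj_pos _ (C.measurable_expWeight_right f h)) t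

theorem ae_iterLaw_traj_pos_of_nearby {ε : ℝ} (hε : 0 ≤ ε) {f : 𝓗} (hf : f ∈ C.nearby fstar ε)
    (t : ℕ) :
    ∀ᵐ past ∂(iterLaw (C.roundKernel fstar p₀ η γ) t),
      ∀ s h, 0 < (C.model f).traj ((past s).2 h) :=
  C.ae_iterLaw_episodes fstar p₀ η γ (p := fun τ => 0 < (C.model f).traj τ)
    (measurableSet_lt measurable_const (C.model f).measurable_traj)
    (fun f' h => (C.logClose_of_mem_nearby hε hf f' h).ae_pos) t

theorem ae_iterLaw_rootRatio_pos {ε : ℝ} (hε : 0 ≤ ε) {f : 𝓗} (hf : f ∈ C.nearby fstar ε)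
    (t : ℕ) :
    ∀ᵐ past ∂(iterLaw (C.roundKernel fstar p₀ η γ) t),
      ∀ s h, 0 < (C.model fstar).rootRatio (C.model f) ((past s).2 h) := by
  filter_upwards [C.ae_iterLaw_traj_pos fstar p₀ η γ t,
    C.ae_iterLaw_traj_pos_of_nearby fstar p₀ η γ hε hf t] with past h1 h2 s h
  exact Model.rootRatio_pos (h1 s h) (h2 s h)

/-- Along the run, -log `rootLik` is a sum of one term per episode, each with conditional mean at
most ε/2 by closeness in divergence. -/
theorem integral_log_rootLik {ε : ℝ} (hε : 0 ≤ ε) {f : 𝓗} (hf : f ∈ C.nearby fstar ε) (t : ℕ)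
    (hp : ∀ s ≤ t, IsProbabilityMeasure (iterLaw (C.roundKernel fstar p₀ η γ) s))
    (hκ : ∀ s < t, ∀ᵐ past ∂(iterLaw (C.roundKernel fstar p₀ η γ) s),
      C.roundKernel fstar p₀ η γ s past Set.univ = 1) :
    Integrable (fun past => Real.log (C.rootLik fstar past f))
        (iterLaw (C.roundKernel fstar p₀ η γ) t) ∧
      ∫ past, -Real.log (C.rootLik fstar past f) ∂(iterLaw (C.roundKernel fstar p₀ η γ) t) ≤
        t * (H * (ε / 2)) := by
  let r : Traj O A H → ℝ := fun τ => -Real.log ((C.model fstar).rootRatio (C.model f) τ)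
  have hr : Measurable r := (Model.measurable_rootRatio _ _).coe_nnreal_real.log.neg
  let k : 𝓗 × (Fin H → Traj O A H) → ℝ := fun x => ∑ h, r (x.2 h)
  have hk : Measurable k := Finset.measurable_sum _ fun h _ =>
    hr.comp ((measurable_pi_apply h).comp measurable_snd)
  have hri : ∀ f' h, Integrable r ((C.model fstar).law (C.expWeight f' h)) := fun f' h =>
    (C.logClose_of_mem_nearby hε hf f' h).integrable.neg
  have hrle : ∀ f' h, ∫⁻ τ, ‖r τ‖ₑ ∂((C.model fstar).law (C.expWeight f' h)) ≤
      ENNReal.ofReal (ε / 2) + 2 := by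
    intro f' h
    have hlin := C.lintegral_rootRatio fstar f f' h
    have hri2 : Integrable (fun τ => ((C.model fstar).rootRatio (C.model f) τ : ℝ))
        ((C.model fstar).law (C.expWeight f' h)) := by
      refine ⟨(Model.measurable_rootRatio _ _).coe_nnreal_real.aestronglyMeasurable, ?_⟩
      rw [hasFiniteIntegral_iff_enorm]
      simp [hlin]
    have hint : ∫ τ, ((C.model fstar).rootRatio (C.model f) τ : ℝ)
        ∂((C.model fstar).law (C.expWeight f' h)) ≤ 1 := by
      rw [integral_eq_lintegral_of_nonneg_ae (.of_forall fun _ => NNReal.coe_nonneg _) hri2.1]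
      simp only [ENNReal.ofReal_coe_nnreal, hlin]
      refine ENNReal.toReal_le_of_le_ofReal zero_le_one (ENNReal.ofReal_le_ofReal ?_)
      linarith [C.trainErr_nonneg fstar f f' h]
    have hle := (C.logClose_of_mem_nearby hε hf f' h).integral_le
    -- From |log x| = -log x + 2 log⁺ x and log⁺ x ≤ x. Since the root ratio has mean at most 1,
    -- this bounds the absolute moment uniformly over the exploring hypothesis f'.
    have h2 : ∀ τ, ‖r τ‖ ≤ r τ + 2 * (C.model fstar).rootRatio (C.model f) τ := by
      intro τ
      simp only [r, Real.norm_eq_abs, abs_neg]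
      have h0 : (0 : ℝ) ≤ (C.model fstar).rootRatio (C.model f) τ := NNReal.coe_nonneg _
      have h1 := Real.log_le_self h0
      rcases abs_cases (Real.log ((C.model fstar).rootRatio (C.model f) τ)) with h | h <;>
        linarith
    rw [← ofReal_integral_norm_eq_lintegral_enorm (hri f' h)]
    have : ∫ τ, ‖r τ‖ ∂((C.model fstar).law (C.expWeight f' h)) ≤ ε / 2 + 2 := by
      refine (integral_mono (hri f' h).norm ((hri f' h).add (hri2.const_mul 2)) h2).trans ?_
      rw [integral_add' (hri f' h) (hri2.const_mul 2), integral_const_mul]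
      simp only [r]
      linarith
    refine (ENNReal.ofReal_le_ofReal this).trans ?_
    rw [ENNReal.ofReal_add (by positivity) (by norm_num)]
    simp
  have hkf : ∀ f', ∫⁻ D, ‖k (f', D)‖ₑ ∂(C.episodes fstar f') ≤
      H * (ENNReal.ofReal (ε / 2) + 2) := by
    intro f'
    calc ∫⁻ D, ‖k (f', D)‖ₑ ∂(C.episodes fstar f')
        ≤ ∫⁻ D, ∑ h, ‖r (D h)‖ₑ ∂(C.episodes fstar f') :=
          lintegral_mono fun D => enorm_sum_le _ _
      _ = ∑ h, ∫⁻ D, ‖r (D h)‖ₑ ∂(C.episodes fstar f') :=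
          lintegral_finsetSum _ fun h _ => (hr.comp (measurable_pi_apply h)).enorm
      _ = ∑ h, ∫⁻ τ, ‖r τ‖ₑ ∂((C.model fstar).law (C.expWeight f' h)) :=
          Finset.sum_congr rfl fun h _ =>
            (C.measurePreserving_episodes fstar f' h).lintegral_comp hr.enorm
      _ ≤ ∑ _h : Fin H, (ENNReal.ofReal (ε / 2) + 2) := Finset.sum_le_sum fun h _ => hrle f' h
      _ = _ := by simp [mul_add]
  have hkint : ∀ f', ∫ D, k (f', D) ∂(C.episodes fstar f') ≤ H * (ε / 2) := by
    intro f'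
    have hmp := C.measurePreserving_episodes fstar f'
    have hmi : ∀ h, Integrable (fun D => r (D h)) (C.episodes fstar f') := fun h =>
      (hmp h).integrable_comp_of_integrable (hri f' h)
    simp only [k]
    rw [integral_finsetSum _ fun h _ => hmi h]
    refine (Finset.sum_le_sum (g := fun _ => ε / 2) fun h _ => ?_).trans (by simp)
    have := integral_map (μ := C.episodes fstar f') (hmp h).measurable.aemeasurable
      (f := r) hr.aestronglyMeasurable
    rw [← this, (hmp h).map_eq]
    exact (C.logClose_of_mem_nearby hε hf f' h).integral_le
  have hc₁ : (H : ℝ≥0∞) * (ENNReal.ofReal (ε / 2) + 2) ≠ ∞ := by finiteness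
  have hk₁ : ∀ t (past : Fin t → 𝓗 × (Fin H → Traj O A H)),
      ∫⁻ x, ‖k x‖ₑ ∂(C.roundKernel fstar p₀ η γ t past) ≤ H * (ENNReal.ofReal (ε / 2) + 2) :=
    fun t past => C.lintegral_roundKernel_le fstar p₀ η γ past hk.enorm hkf
  have hk₂ : ∀ t (past : Fin t → 𝓗 × (Fin H → Traj O A H)),
      ∫ x, k x ∂(C.roundKernel fstar p₀ η γ t past) ≤ H * (ε / 2) := fun t past =>
    C.integral_roundKernel_le fstar p₀ η γ past
      ⟨hk.aestronglyMeasurable, hasFiniteIntegral_iff_enorm.2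
        ((hk₁ t past).trans_lt hc₁.lt_top)⟩ (by positivity) hkint
  obtain ⟨hi, hle⟩ := integral_sum_iterLaw_le hk hc₁ hk₁ hk₂ t hp hκ
  have hae : (fun past => ∑ s, k (past s)) =ᵐ[iterLaw (C.roundKernel fstar p₀ η γ) t]
      fun past => -Real.log (C.rootLik fstar past f) := by
    filter_upwards [C.ae_iterLaw_rootRatio_pos fstar p₀ η γ hε hf t] with past hpast
    have h0 : ∀ s h, ((C.model fstar).rootRatio (C.model f) ((past s).2 h) : ℝ) ≠ 0 :=
      fun s h => by exact_mod_cast (hpast s h).ne'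
    simp only [rootLik, NNReal.coe_prod, k, r]
    rw [Real.log_prod fun s _ => Finset.prod_ne_zero_iff.2 fun h _ => h0 s h,
      ← Finset.sum_neg_distrib]
    refine Finset.sum_congr rfl fun s _ => ?_
    rw [Real.log_prod fun h _ => h0 s h, Finset.sum_neg_distrib]
  refine ⟨(integrable_neg_iff (f := fun past => Real.log (C.rootLik fstar past f))).1
    (hi.congr hae), ?_⟩
  rwa [integral_congr_ae hae] at hle

end PSRClass

/-! ### The optimistic posterior: normalization and control of one round -/

namespace PSRClass

variable {𝓗 O A : Type*} [MeasurableSpace 𝓗] [MeasurableSpace O] [MeasurableSpace A]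
  [DiscreteMeasurableSpace A] [Fintype A] [Nonempty A] {ν : Measure O} [SigmaFinite ν] {H : ℕ}
  (C : PSRClass 𝓗 ν A H) (fstar : 𝓗) (p₀ : Measure 𝓗) [IsProbabilityMeasure p₀] (γ : ℝ)

/-- The posterior weight of `f`, relative to that of `fstar`. -/
def relWeight {t : ℕ} (past : Fin t → 𝓗 × (Fin H → Traj O A H)) (f : 𝓗) : ℝ≥0 :=
  Real.toNNReal (Real.exp (γ * ((C.model f).optValue - (C.model fstar).optValue))) *
    C.rootLik fstar past f

theorem measurable_relWeight (t : ℕ) :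
    Measurable fun x : (Fin t → 𝓗 × (Fin H → Traj O A H)) × 𝓗 => C.relWeight fstar γ x.1 x.2 :=
  (((C.measurable_optValue.comp measurable_snd).sub_const _).const_mul γ).exp.real_toNNReal.mul
    (C.measurable_rootLik fstar t)

/-- The posterior weight of `fstar`. -/
def starWeight {t : ℕ} (past : Fin t → 𝓗 × (Fin H → Traj O A H)) : ℝ≥0 :=
  Real.toNNReal (Real.exp (γ * (C.model fstar).optValue)) *
    ∏ s, ∏ h, NNReal.sqrt ((C.model fstar).traj ((past s).2 h))

/-- The factor `starWeight` does not depend on f and cancels in the normalized posterior, which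
leaves weights that can be compared with exponential moments. -/
theorem postWeight_eq {t : ℕ} {past : Fin t → 𝓗 × (Fin H → Traj O A H)}
    (hpos : ∀ s h, 0 < (C.model fstar).traj ((past s).2 h)) (f : 𝓗) :
    C.postWeight (1 / 2) γ (data past) f =
      (C.starWeight fstar γ past : ℝ≥0∞) * C.relWeight fstar γ past f := by
  have h1 : ENNReal.ofReal (Real.exp (γ * (C.model f).optValue)) =
      ENNReal.ofReal (Real.exp (γ * (C.model fstar).optValue)) *
        ENNReal.ofReal (Real.exp (γ * ((C.model f).optValue - (C.model fstar).optValue))) := by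
    rw [← ENNReal.ofReal_mul (Real.exp_pos _).le, ← Real.exp_add]
    congr 2
    ring
  have h2 : ∀ s h, (C.model f).traj ((past s).2 h) ^ (1 / 2 : ℝ) =
      NNReal.sqrt ((C.model fstar).traj ((past s).2 h)) *
        (C.model fstar).rootRatio (C.model f) ((past s).2 h) := by
    intro s h
    rw [← NNReal.sqrt_eq_rpow, Model.rootRatio, ← NNReal.sqrt_mul,
      mul_div_cancel₀ _ (hpos s h).ne']
  simp only [postWeight, data, h1, h2, starWeight, relWeight, rootLik]
  push_cast
  simp only [Finset.prod_mul_distrib, ENNReal.ofReal]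
  ring

theorem starWeight_pos {t : ℕ} {past : Fin t → 𝓗 × (Fin H → Traj O A H)}
    (hpos : ∀ s h, 0 < (C.model fstar).traj ((past s).2 h)) : 0 < C.starWeight fstar γ past :=
  mul_pos (Real.toNNReal_pos.2 (Real.exp_pos _)) <|
    Finset.prod_pos fun s _ => Finset.prod_pos fun h _ => NNReal.sqrt_pos.2 (hpos s h)

theorem evidence_eq {t : ℕ} {past : Fin t → 𝓗 × (Fin H → Traj O A H)}
    (hpos : ∀ s h, 0 < (C.model fstar).traj ((past s).2 h)) :
    C.evidence p₀ (1 / 2) γ (data past) =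
      (C.starWeight fstar γ past : ℝ≥0∞) * ∫⁻ f, C.relWeight fstar γ past f ∂p₀ := by
  simp only [evidence, C.postWeight_eq fstar γ hpos]
  exact lintegral_const_mul' _ _ ENNReal.coe_ne_top

theorem postDensity_eq {t : ℕ} {past : Fin t → 𝓗 × (Fin H → Traj O A H)}
    (hpos : ∀ s h, 0 < (C.model fstar).traj ((past s).2 h)) (f : 𝓗) :
    C.postDensity p₀ (1 / 2) γ past f =
      (∫⁻ f, C.relWeight fstar γ past f ∂p₀)⁻¹ * C.relWeight fstar γ past f := by
  have hs : (C.starWeight fstar γ past : ℝ≥0∞) ≠ 0 := by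
    simpa using (C.starWeight_pos fstar γ hpos).ne'
  rw [postDensity, C.evidence_eq fstar p₀ γ hpos, C.postWeight_eq fstar γ hpos,
    ENNReal.mul_inv (.inl hs) (.inl ENNReal.coe_ne_top), mul_comm (_⁻¹), mul_assoc,
    ← mul_assoc (C.starWeight fstar γ past : ℝ≥0∞)⁻¹,
    ENNReal.inv_mul_cancel hs ENNReal.coe_ne_top, one_mul]

/-- The change-of-measure bound for the law of the first `t` rounds. -/
theorem integral_iterLaw_le_of_exp_mul_le (hγ : 0 ≤ γ) {ε : ℝ} (hε : 0 ≤ ε)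
    (hB : p₀ (C.nearby fstar ε) ≠ 0) (t : ℕ)
    (hp : ∀ s ≤ t, IsProbabilityMeasure (iterLaw (C.roundKernel fstar p₀ (1 / 2) γ) s))
    (hκ : ∀ s < t, ∀ᵐ past ∂(iterLaw (C.roundKernel fstar p₀ (1 / 2) γ) s),
      C.roundKernel fstar p₀ (1 / 2) γ s past Set.univ = 1)
    {g : (Fin t → 𝓗 × (Fin H → Traj O A H)) → ℝ} (hg : Measurable g)
    (hgi : Integrable g (iterLaw (C.roundKernel fstar p₀ (1 / 2) γ) t))
    {Y : (Fin t → 𝓗 × (Fin H → Traj O A H)) → ℝ≥0∞} {y : ℝ} (hy : 0 ≤ y)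
    (hY : ∫⁻ past, Y past ∂(iterLaw (C.roundKernel fstar p₀ (1 / 2) γ) t) ≤ ENNReal.ofReal y)
    (hgY : ∀ᵐ past ∂(iterLaw (C.roundKernel fstar p₀ (1 / 2) γ) t),
      ENNReal.ofReal (Real.exp (g past)) * ∫⁻ f, C.relWeight fstar γ past f ∂p₀ ≤ Y past) :
    ∫ past, g past ∂(iterLaw (C.roundKernel fstar p₀ (1 / 2) γ) t) ≤
      γ * ε + t * (H * (ε / 2)) - Real.log (p₀ (C.nearby fstar ε)).toReal + y - 1 := by
  have := hp t le_rfl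
  have hlik : ∀ f ∈ C.nearby fstar ε,
      ∀ᵐ past ∂(iterLaw (C.roundKernel fstar p₀ (1 / 2) γ) t), 0 < C.rootLik fstar past f := by
    intro f hf
    filter_upwards [C.ae_iterLaw_rootRatio_pos fstar p₀ (1 / 2) γ hε hf t] with past h
    exact Finset.prod_pos fun s _ => Finset.prod_pos fun i _ => h s i
  have hlog : ∀ f ∈ C.nearby fstar ε, (fun past => Real.log (C.relWeight fstar γ past f))
      =ᵐ[iterLaw (C.roundKernel fstar p₀ (1 / 2) γ) t] fun past =>
        γ * ((C.model f).optValue - (C.model fstar).optValue) +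
          Real.log (C.rootLik fstar past f) := by
    intro f hf
    filter_upwards [hlik f hf] with past h
    have h' : (C.rootLik fstar past f : ℝ) ≠ 0 := by exact_mod_cast h.ne'
    rw [relWeight, NNReal.coe_mul, Real.coe_toNNReal _ (Real.exp_pos _).le,
      Real.log_mul (Real.exp_pos _).ne' h', Real.log_exp]
  refine integral_le_of_exp_mul_lintegral_le (w := fun past f => C.relWeight fstar γ past f)
    (C.measurable_relWeight fstar γ t) hg hgi hy hY hgY hB ?_ ?_ ?_
  · intro f hf
    filter_upwards [hlik f hf] with past h
    exact mul_pos (Real.toNNReal_pos.2 (Real.exp_pos _)) h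
  · intro f hf
    obtain ⟨hi, -⟩ := C.integral_log_rootLik fstar p₀ (1 / 2) γ hε hf t hp hκ
    exact ((integrable_const _).add hi).congr (hlog f hf).symm
  · intro f hf
    obtain ⟨hi, hle⟩ := C.integral_log_rootLik fstar p₀ (1 / 2) γ hε hf t hp hκ
    rw [integral_neg] at hle ⊢
    rw [integral_congr_ae (hlog f hf), integral_add (integrable_const _) hi, integral_const,
      probReal_univ, one_smul]
    -- The value part of closeness costs γε; the divergence part contributes the ε/2 per episode.
    have := mul_le_mul_of_nonneg_left hf.1 hγ
    linarith

theorem measurable_lintegral_relWeight (t : ℕ) :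
    Measurable fun past : Fin t → 𝓗 × (Fin H → Traj O A H) =>
      ∫⁻ f, (C.relWeight fstar γ past f : ℝ≥0∞) ∂p₀ :=
  (C.measurable_relWeight fstar γ t).coe_nnreal_ennreal.lintegral_prod_right'

/-- Crude: V_f - V^* ≤ 1, and exp(`pastErr`) ≥ 1 can be inserted for free. The value of the bound is
immaterial; its finiteness makes the posterior well defined. -/
theorem lintegral_lintegral_relWeight_le (hγ : 0 ≤ γ) (t : ℕ) :
    ∫⁻ past, ∫⁻ f, C.relWeight fstar γ past f ∂p₀
      ∂(iterLaw (C.roundKernel fstar p₀ (1 / 2) γ) t) ≤ ENNReal.ofReal (Real.exp γ) := by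
  calc _ ≤ ∫⁻ past, ENNReal.ofReal (Real.exp γ) * ∫⁻ f, C.rootLik fstar past f *
          ENNReal.ofReal (Real.exp (C.pastErr fstar past f)) ∂p₀
          ∂(iterLaw (C.roundKernel fstar p₀ (1 / 2) γ) t) := by
        refine lintegral_mono fun past => ?_
        rw [← lintegral_const_mul' _ _ ENNReal.ofReal_ne_top]
        refine lintegral_mono fun f => ?_
        rw [relWeight, ENNReal.coe_mul]
        refine mul_le_mul' (ENNReal.ofReal_le_ofReal (Real.exp_le_exp.2 ?_)) ?_
        · have h1 := C.optValue_le_one f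
          have h2 := C.optValue_nonneg fstar
          nlinarith
        · refine le_mul_of_one_le_right' ?_
          rw [← ENNReal.ofReal_one]
          exact ENNReal.ofReal_le_ofReal (Real.one_le_exp (C.pastErr_nonneg fstar past f))
    _ = ENNReal.ofReal (Real.exp γ) * ∫⁻ past, ∫⁻ f, C.rootLik fstar past f *
          ENNReal.ofReal (Real.exp (C.pastErr fstar past f)) ∂p₀
          ∂(iterLaw (C.roundKernel fstar p₀ (1 / 2) γ) t) :=
        lintegral_const_mul' _ _ ENNReal.ofReal_ne_top
    _ ≤ _ := mul_le_of_le_one_right' (C.lintegral_lintegral_rootLik_le fstar p₀ (1 / 2) γ t)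

/-- On the event S where the normalizing constant vanishes, exp(g) times it is 0 for every g. The
change-of-measure bound with g = N · 1_S therefore keeps N P(S) bounded as N grows, which forces
P(S) = 0. -/
theorem ae_lintegral_relWeight_ne_zero (hγ : 0 ≤ γ) {ε : ℝ} (hε : 0 ≤ ε)
    (hB : p₀ (C.nearby fstar ε) ≠ 0) (t : ℕ)
    (hp : ∀ s ≤ t, IsProbabilityMeasure (iterLaw (C.roundKernel fstar p₀ (1 / 2) γ) s))
    (hκ : ∀ s < t, ∀ᵐ past ∂(iterLaw (C.roundKernel fstar p₀ (1 / 2) γ) s),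
      C.roundKernel fstar p₀ (1 / 2) γ s past Set.univ = 1) :
    ∀ᵐ past ∂(iterLaw (C.roundKernel fstar p₀ (1 / 2) γ) t),
      ∫⁻ f, (C.relWeight fstar γ past f : ℝ≥0∞) ∂p₀ ≠ 0 := by
  have := hp t le_rfl
  set P := iterLaw (C.roundKernel fstar p₀ (1 / 2) γ) t
  let S : Set (Fin t → 𝓗 × (Fin H → Traj O A H)) :=
    {past | ∫⁻ f, (C.relWeight fstar γ past f : ℝ≥0∞) ∂p₀ = 0}
  have hS : MeasurableSet S :=
    C.measurable_lintegral_relWeight fstar p₀ γ t (measurableSet_singleton 0)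
  have key : ∀ N : ℕ, N * P.real S ≤ γ * ε + t * (H * (ε / 2)) -
      Real.log (p₀ (C.nearby fstar ε)).toReal + Real.exp γ - 1 := by
    intro N
    have h := C.integral_iterLaw_le_of_exp_mul_le fstar p₀ γ hγ hε hB t hp hκ
      (g := S.indicator fun _ => (N : ℝ)) (measurable_const.indicator hS)
      ((integrable_const _).indicator hS) (Real.exp_pos γ).le
      (C.lintegral_lintegral_relWeight_le fstar p₀ γ hγ t) (.of_forall fun past => ?_)
    · rwa [integral_indicator_const _ hS, smul_eq_mul, mul_comm] at h
    · by_cases hpast : past ∈ S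
      · have : ∫⁻ f, (C.relWeight fstar γ past f : ℝ≥0∞) ∂p₀ = 0 := hpast
        simp [this]
      · simp [hpast]
  have h0 : P.real S = 0 := by
    refine le_antisymm ?_ measureReal_nonneg
    by_contra! hlt
    obtain ⟨N, hN⟩ := exists_nat_gt ((γ * ε + t * (H * (ε / 2)) -
      Real.log (p₀ (C.nearby fstar ε)).toReal + Real.exp γ - 1) / P.real S)
    rw [div_lt_iff₀ hlt] at hN
    linarith [key N]
  rw [ae_iff]
  simp only [ne_eq, not_not]
  exact (measureReal_eq_zero_iff).1 h0

theorem ae_roundKernel_univ (hγ : 0 ≤ γ) {ε : ℝ} (hε : 0 ≤ ε)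
    (hB : p₀ (C.nearby fstar ε) ≠ 0) (t : ℕ)
    (hp : ∀ s ≤ t, IsProbabilityMeasure (iterLaw (C.roundKernel fstar p₀ (1 / 2) γ) s))
    (hκ : ∀ s < t, ∀ᵐ past ∂(iterLaw (C.roundKernel fstar p₀ (1 / 2) γ) s),
      C.roundKernel fstar p₀ (1 / 2) γ s past Set.univ = 1) :
    ∀ᵐ past ∂(iterLaw (C.roundKernel fstar p₀ (1 / 2) γ) t),
      C.roundKernel fstar p₀ (1 / 2) γ t past Set.univ = 1 := by
  have htop := ae_lt_top (C.measurable_lintegral_relWeight fstar p₀ γ t)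
    (ne_top_of_le_ne_top ENNReal.ofReal_ne_top
      (C.lintegral_lintegral_relWeight_le fstar p₀ γ hγ t))
  filter_upwards [htop, C.ae_lintegral_relWeight_ne_zero fstar p₀ γ hγ hε hB t hp hκ,
    C.ae_iterLaw_traj_pos fstar p₀ (1 / 2) γ t] with past h1 h2 h3
  rw [roundKernel_univ, posteriorKernel_univ, C.evidence_eq fstar p₀ γ h3]
  refine ENNReal.inv_mul_cancel (mul_ne_zero ?_ h2) (ENNReal.mul_ne_top ENNReal.coe_ne_top h1.ne)
  simpa using (C.starWeight_pos fstar γ h3).ne'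

/-- Both statements are proved in one induction: the change of measure needs a probability law for
the past in order to show that the next posterior is almost surely normalized, and this makes the
next law a probability measure. -/
theorem isProbabilityMeasure_iterLaw (hγ : 0 ≤ γ) {ε : ℝ} (hε : 0 ≤ ε)
    (hB : p₀ (C.nearby fstar ε) ≠ 0) (t : ℕ) :
    (∀ s ≤ t, IsProbabilityMeasure (iterLaw (C.roundKernel fstar p₀ (1 / 2) γ) s)) ∧
    ∀ s < t, ∀ᵐ past ∂(iterLaw (C.roundKernel fstar p₀ (1 / 2) γ) s),
      C.roundKernel fstar p₀ (1 / 2) γ s past Set.univ = 1 := by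
  induction t with
  | zero =>
    refine ⟨fun s hs => ?_, fun s hs => absurd hs (Nat.not_lt_zero s)⟩
    obtain rfl : s = 0 := by omega
    unfold iterLaw
    infer_instance
  | succ t ih =>
    have hk := C.ae_roundKernel_univ fstar p₀ γ hγ hε hB t ih.1 ih.2
    refine ⟨fun s hs => ?_, fun s hs => ?_⟩
    · rcases Nat.le_succ_iff.1 hs with h | rfl
      · exact ih.1 s h
      · exact isProbabilityMeasure_iterLaw_succ (ih.1 t le_rfl) hk
    · rcases Nat.lt_succ_iff_lt_or_eq.1 hs with h | rfl
      · exact ih.2 s h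
      · exact hk

/-- What one round contributes to the potential that the posterior controls. -/
def roundGap {t : ℕ} (past : Fin t → 𝓗 × (Fin H → Traj O A H)) (f : 𝓗) : ℝ :=
  γ * ((C.model fstar).optValue - (C.model f).optValue) + C.pastErr fstar past f

theorem measurable_roundGap (t : ℕ) :
    Measurable fun x : (Fin t → 𝓗 × (Fin H → Traj O A H)) × 𝓗 => C.roundGap fstar γ x.1 x.2 :=
  (((C.measurable_optValue.comp measurable_snd).const_sub _).const_mul γ).add
    (C.measurable_pastErr fstar t)

/-- Values lie in [0, 1] and squared Hellinger distances are at most 1; this boundedness settles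
integrability and makes Jensen's inequality applicable. -/
theorem abs_roundGap_le (hγ : 0 ≤ γ) {t : ℕ} (past : Fin t → 𝓗 × (Fin H → Traj O A H)) (f : 𝓗) :
    |C.roundGap fstar γ past f| ≤ γ + t * H := by
  have h1 := C.optValue_le_one f
  have h2 := C.optValue_nonneg fstar
  have h3 := C.optValue_le_one fstar
  have h4 := C.optValue_nonneg f
  have h5 := C.pastErr_nonneg fstar past f
  have h6 := C.pastErr_le fstar past f
  rw [roundGap, abs_le]
  constructor <;> nlinarith

theorem integral_roundGap_le (hγ : 0 ≤ γ) {ε : ℝ} (hε : 0 ≤ ε)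
    (hB : p₀ (C.nearby fstar ε) ≠ 0) (t : ℕ) :
    ∫ past, ∫ f, C.roundGap fstar γ past f ∂(C.posteriorKernel p₀ (1 / 2) γ t past)
        ∂(iterLaw (C.roundKernel fstar p₀ (1 / 2) γ) t) ≤
      γ * ε + t * (H * (ε / 2)) - Real.log (p₀ (C.nearby fstar ε)).toReal := by
  obtain ⟨hp, hκ⟩ := C.isProbabilityMeasure_iterLaw fstar p₀ γ hγ hε hB (t + 1)
  have := hp t (by omega)
  have hmg : Measurable fun past : Fin t → 𝓗 × (Fin H → Traj O A H) =>
      ∫ f, C.roundGap fstar γ past f ∂(C.posteriorKernel p₀ (1 / 2) γ t past) :=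
    ((C.measurable_roundGap fstar γ t).stronglyMeasurable.integral_kernel_prod_right').measurable
  have hφm : ∀ past : Fin t → 𝓗 × (Fin H → Traj O A H),
      Measurable fun f => C.roundGap fstar γ past f := fun past =>
    Measurable.of_uncurry_left (f := fun past f => C.roundGap fstar γ past f)
      (C.measurable_roundGap fstar γ t)
  have hbd : ∀ past : Fin t → 𝓗 × (Fin H → Traj O A H),
      ‖∫ f, C.roundGap fstar γ past f ∂(C.posteriorKernel p₀ (1 / 2) γ t past)‖ ≤
        γ + t * H := by
    intro past
    refine (norm_integral_le_of_norm_le_const (C := γ + t * H)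
      (.of_forall fun f => C.abs_roundGap_le fstar γ hγ past f)).trans ?_
    refine mul_le_of_le_one_right (by positivity) ?_
    exact ENNReal.toReal_le_of_le_ofReal zero_le_one
      (by simpa using C.posteriorKernel_univ_le p₀ (1 / 2) γ past)
  -- Here g is the posterior mean of the gap and Y the prior mean of `rootLik` · exp(`pastErr`). The
  -- latter has expectation at most 1, so y = 1 and the term y - 1 disappears.
  have := C.integral_iterLaw_le_of_exp_mul_le fstar p₀ γ hγ hε hB t (fun s hs => hp s (by omega))
    (fun s hs => hκ s (by omega)) hmg
    (Integrable.of_bound hmg.aestronglyMeasurable _ (.of_forall hbd)) zero_le_one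
    ((C.lintegral_lintegral_rootLik_le fstar p₀ (1 / 2) γ t).trans (by simp)) ?_
  · linarith
  · filter_upwards [hκ t (by omega), C.ae_iterLaw_traj_pos fstar p₀ (1 / 2) γ t] with past h1 h2
    rw [roundKernel_univ] at h1
    have : IsProbabilityMeasure (C.posteriorKernel p₀ (1 / 2) γ t past) := ⟨h1⟩
    have hi : Integrable (fun f => C.roundGap fstar γ past f)
        (C.posteriorKernel p₀ (1 / 2) γ t past) :=
      Integrable.of_bound (hφm past).aestronglyMeasurable _
        (.of_forall fun f => C.abs_roundGap_le fstar γ hγ past f)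
    have hie : Integrable (fun f => Real.exp (C.roundGap fstar γ past f))
        (C.posteriorKernel p₀ (1 / 2) γ t past) := by
      refine Integrable.of_bound (hφm past).exp.aestronglyMeasurable (Real.exp (γ + t * H))
        (.of_forall fun f => ?_)
      rw [Real.norm_of_nonneg (Real.exp_pos _).le]
      exact Real.exp_le_exp.2 ((le_abs_self _).trans (C.abs_roundGap_le fstar γ hγ past f))
    -- Jensen's inequality under the posterior, which is a probability measure for this past.
    have hJ := convexOn_exp.map_integral_le Real.continuous_exp.continuousOn isClosed_univ
      (.of_forall fun f => Set.mem_univ _) hi hie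
    have hden : Measurable (C.postDensity p₀ (1 / 2) γ past) :=
      (C.measurable_postDensity p₀ (1 / 2) γ t).of_uncurry_left
    have hYm : Measurable fun f => (C.rootLik fstar past f : ℝ≥0∞) *
        ENNReal.ofReal (Real.exp (C.pastErr fstar past f)) :=
      Measurable.of_uncurry_left (f := fun past f => (C.rootLik fstar past f : ℝ≥0∞) *
        ENNReal.ofReal (Real.exp (C.pastErr fstar past f)))
        ((C.measurable_rootLik fstar t).coe_nnreal_ennreal.mul
          (C.measurable_pastErr fstar t).exp.ennreal_ofReal)
    set Z := ∫⁻ f, (C.relWeight fstar γ past f : ℝ≥0∞) ∂p₀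
    calc _ ≤ (∫⁻ f, ENNReal.ofReal (Real.exp (C.roundGap fstar γ past f))
            ∂(C.posteriorKernel p₀ (1 / 2) γ t past)) * Z := by
          rw [← ofReal_integral_eq_lintegral_ofReal hie (.of_forall fun f => (Real.exp_pos _).le)]
          gcongr
      _ = (Z⁻¹ * ∫⁻ f, C.rootLik fstar past f *
            ENNReal.ofReal (Real.exp (C.pastErr fstar past f)) ∂p₀) * Z := by
          rw [posteriorKernel_apply', lintegral_withDensity_eq_lintegral_mul _ hden
            (hφm past).exp.ennreal_ofReal, ← lintegral_const_mul _ hYm]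
          congr 1
          refine lintegral_congr fun f => ?_
          rw [Pi.mul_apply, C.postDensity_eq fstar p₀ γ h2, mul_assoc, relWeight, ENNReal.coe_mul,
            roundGap, Real.exp_add, ENNReal.ofReal_mul (Real.exp_pos _).le]
          -- The optimism factor of the posterior weight is the inverse of the value part of the
          -- exponentiated gap, so only `rootLik` · exp(`pastErr`) remains.
          have e : ((Real.exp (γ * ((C.model f).optValue -
              (C.model fstar).optValue))).toNNReal : ℝ≥0∞) *
              ENNReal.ofReal (Real.exp (γ * ((C.model fstar).optValue -
                (C.model f).optValue))) = 1 := by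
            change ENNReal.ofReal _ * _ = 1
            rw [← ENNReal.ofReal_mul (Real.exp_pos _).le, ← Real.exp_add, ← ENNReal.ofReal_one,
              ← Real.exp_zero]
            congr 2
            ring
          congr 1
          calc _ = (((Real.exp (γ * ((C.model f).optValue -
              (C.model fstar).optValue))).toNNReal : ℝ≥0∞) *
              ENNReal.ofReal (Real.exp (γ * ((C.model fstar).optValue -
                (C.model f).optValue)))) * (C.rootLik fstar past f *
                ENNReal.ofReal (Real.exp (C.pastErr fstar past f))) := by ring
            _ = _ := by rw [e, one_mul]
      _ = (Z⁻¹ * Z) * ∫⁻ f, C.rootLik fstar past f *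
            ENNReal.ofReal (Real.exp (C.pastErr fstar past f)) ∂p₀ := by ring
      _ ≤ _ := mul_le_of_le_one_left' (ENNReal.inv_mul_le_one _)

end PSRClass

/-! ### From the potential to the regret -/

namespace PSRClass

variable {𝓗 O A : Type*} [MeasurableSpace 𝓗] [MeasurableSpace O] [MeasurableSpace A]
  [DiscreteMeasurableSpace A] [Fintype A] [Nonempty A] {ν : Measure O} [SigmaFinite ν] {H : ℕ}
  (C : PSRClass 𝓗 ν A H) (fstar : 𝓗) (p₀ : Measure 𝓗) [IsProbabilityMeasure p₀] (γ : ℝ)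

/-- The regret of a run. -/
def regret {t : ℕ} (run : Fin t → 𝓗 × (Fin H → Traj O A H)) : ℝ :=
  ∑ s, ((C.model fstar).optValue - (C.model fstar).value (C.optPolicy (run s).1))

/-- The total optimism deficit `∑ (V^* - V_f)` of a run. -/
def deficit {t : ℕ} (run : Fin t → 𝓗 × (Fin H → Traj O A H)) : ℝ :=
  ∑ s, ((C.model fstar).optValue - (C.model (run s).1).optValue)

/-- The total training error of a run. -/
def totalErr {t : ℕ} (run : Fin t → 𝓗 × (Fin H → Traj O A H)) : ℝ :=
  ∑ h : Fin H, ∑ t' : Fin t, ∑ s ∈ Finset.Iio t', C.trainErr fstar (run t').1 (run s).1 h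

theorem measurable_regret (t : ℕ) :
    Measurable fun run : Fin t → 𝓗 × (Fin H → Traj O A H) => C.regret fstar run :=
  Finset.measurable_sum _ fun s _ => ((C.measurable_value_optPolicy fstar).comp
    (f := fun run : Fin t → 𝓗 × (Fin H → Traj O A H) => (run s).1) (by fun_prop)).const_sub _

theorem measurable_deficit (t : ℕ) :
    Measurable fun run : Fin t → 𝓗 × (Fin H → Traj O A H) => C.deficit fstar run :=
  Finset.measurable_sum _ fun s _ => (C.measurable_optValue.comp
    (f := fun run : Fin t → 𝓗 × (Fin H → Traj O A H) => (run s).1) (by fun_prop)).const_sub _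

theorem measurable_totalErr (t : ℕ) :
    Measurable fun run : Fin t → 𝓗 × (Fin H → Traj O A H) => C.totalErr fstar run :=
  Finset.measurable_sum _ fun h _ => Finset.measurable_sum _ fun t' _ =>
    Finset.measurable_sum _ fun s _ => (C.measurable_trainErr fstar h).comp
      (f := fun run : Fin t → 𝓗 × (Fin H → Traj O A H) => ((run t').1, (run s).1)) (by fun_prop)

theorem regret_nonneg {t : ℕ} (run : Fin t → 𝓗 × (Fin H → Traj O A H)) :
    0 ≤ C.regret fstar run :=
  Finset.sum_nonneg fun _ _ => sub_nonneg.2 (C.value_le_optValue fstar _)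

theorem regret_le {t : ℕ} (run : Fin t → 𝓗 × (Fin H → Traj O A H)) : C.regret fstar run ≤ t := by
  refine (Finset.sum_le_sum (g := fun _ => (1 : ℝ)) fun s _ => ?_).trans (by simp)
  linarith [C.optValue_le_one fstar, (C.model fstar).value_nonneg (C.optPolicy (run s).1)]

theorem abs_deficit_le {t : ℕ} (run : Fin t → 𝓗 × (Fin H → Traj O A H)) :
    |C.deficit fstar run| ≤ t := by
  refine (Finset.abs_sum_le_sum_abs _ _).trans
    ((Finset.sum_le_sum (g := fun _ => (1 : ℝ)) fun s _ => ?_).trans (by simp))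
  rw [abs_le]
  constructor <;> linarith [C.optValue_le_one fstar, C.optValue_nonneg fstar,
    C.optValue_le_one (run s).1, C.optValue_nonneg (run s).1]

theorem totalErr_nonneg {t : ℕ} (run : Fin t → 𝓗 × (Fin H → Traj O A H)) :
    0 ≤ C.totalErr fstar run :=
  Finset.sum_nonneg fun _ _ => Finset.sum_nonneg fun _ _ => Finset.sum_nonneg fun _ _ =>
    C.trainErr_nonneg _ _ _ _

theorem totalErr_le {t : ℕ} (run : Fin t → 𝓗 × (Fin H → Traj O A H)) :
    C.totalErr fstar run ≤ H * (t * t) := by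
  refine (Finset.sum_le_sum (g := fun _ => (t * t : ℝ)) fun h _ => ?_).trans (by simp)
  refine (Finset.sum_le_sum (g := fun _ => (t : ℝ)) fun t' _ => ?_).trans (by simp)
  refine (Finset.sum_le_sum (g := fun _ => (1 : ℝ)) fun s _ => C.trainErr_le_one _ _ _ _).trans ?_
  simp only [Finset.sum_const, nsmul_eq_mul, mul_one, Fin.card_Iio]
  exact_mod_cast t'.isLt.le

theorem deficit_snocRound {t : ℕ} (p : (Fin t → 𝓗 × (Fin H → Traj O A H)) × _) :
    C.deficit fstar (snocRound p) =
      C.deficit fstar p.1 + ((C.model fstar).optValue - (C.model p.2.1).optValue) := by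
  simp only [deficit, Fin.sum_univ_castSucc, snocRound_castSucc, snocRound_last]

theorem totalErr_snocRound {t : ℕ} (p : (Fin t → 𝓗 × (Fin H → Traj O A H)) × _) :
    C.totalErr fstar (snocRound p) = C.totalErr fstar p.1 + C.pastErr fstar p.1 p.2.1 := by
  simp only [totalErr, pastErr, Fin.sum_univ_castSucc, Fin.Iio_castSucc, Fin.Iio_last_eq_map,
    Finset.sum_map, Fin.castSuccEmb_apply, snocRound_castSucc, snocRound_last,
    Finset.sum_add_distrib]
  rw [Finset.sum_comm (s := (Finset.univ : Finset (Fin t)))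
    (f := fun s h => C.trainErr fstar p.2.1 (p.1 s).1 h)]

theorem integrable_of_abs_le {t : ℕ} {F : (Fin t → 𝓗 × (Fin H → Traj O A H)) → ℝ}
    (hF : Measurable F) {c : ℝ} (h : ∀ run, |F run| ≤ c) :
    Integrable F (iterLaw (C.roundKernel fstar p₀ (1 / 2) γ) t) :=
  Integrable.of_bound hF.aestronglyMeasurable c (.of_forall h)

/-- The potential grows by the `roundGap` of the new hypothesis, and the gap does not depend on the
trajectories of the new round. Its conditional mean is thus an integral over the posterior alone. -/
theorem integral_potential_succ (hγ : 0 ≤ γ) {ε : ℝ} (hε : 0 ≤ ε)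
    (hB : p₀ (C.nearby fstar ε) ≠ 0) (t : ℕ) :
    ∫ run, (γ * C.deficit fstar run + C.totalErr fstar run)
        ∂(iterLaw (C.roundKernel fstar p₀ (1 / 2) γ) (t + 1)) =
      ∫ run, (γ * C.deficit fstar run + C.totalErr fstar run)
        ∂(iterLaw (C.roundKernel fstar p₀ (1 / 2) γ) t) +
      ∫ past, ∫ f, C.roundGap fstar γ past f ∂(C.posteriorKernel p₀ (1 / 2) γ t past)
        ∂(iterLaw (C.roundKernel fstar p₀ (1 / 2) γ) t) := by
  obtain ⟨-, hκ⟩ := C.isProbabilityMeasure_iterLaw fstar p₀ γ hγ hε hB (t + 1)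
  have hκt := hκ t (by omega)
  have hmS : ∀ t, Measurable fun run : Fin t → 𝓗 × (Fin H → Traj O A H) =>
      γ * C.deficit fstar run + C.totalErr fstar run := fun t =>
    ((C.measurable_deficit fstar t).const_mul γ).add (C.measurable_totalErr fstar t)
  have hbS : ∀ run : Fin t → 𝓗 × (Fin H → Traj O A H),
      |γ * C.deficit fstar run + C.totalErr fstar run| ≤ γ * t + H * (t * t) := by
    intro run
    refine (abs_add_le _ _).trans (add_le_add ?_ ?_)
    · rw [abs_mul, abs_of_nonneg hγ]
      exact mul_le_mul_of_nonneg_left (C.abs_deficit_le fstar run) hγ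
    · rw [abs_of_nonneg (C.totalErr_nonneg fstar run)]
      exact C.totalErr_le fstar run
  have hif := integrable_compProd_fst hκt (hmS t) (C.integrable_of_abs_le fstar p₀ γ (hmS t) hbS)
  have hmG : Measurable fun p : (Fin t → 𝓗 × (Fin H → Traj O A H)) ×
      (𝓗 × (Fin H → Traj O A H)) => C.roundGap fstar γ p.1 p.2.1 :=
    (C.measurable_roundGap fstar γ t).comp
      (f := fun p : (Fin t → 𝓗 × (Fin H → Traj O A H)) × (𝓗 × (Fin H → Traj O A H)) =>
        (p.1, p.2.1)) (by fun_prop)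
  have hiG : Integrable (fun p : (Fin t → 𝓗 × (Fin H → Traj O A H)) ×
      (𝓗 × (Fin H → Traj O A H)) => C.roundGap fstar γ p.1 p.2.1)
      (iterLaw (C.roundKernel fstar p₀ (1 / 2) γ) t ⊗ₘ C.roundKernel fstar p₀ (1 / 2) γ t) :=
    Integrable.of_bound hmG.aestronglyMeasurable (γ + t * H)
      (.of_forall fun p => C.abs_roundGap_le fstar γ hγ p.1 p.2.1)
  have hsum : ∀ p : (Fin t → 𝓗 × (Fin H → Traj O A H)) × (𝓗 × (Fin H → Traj O A H)),
      γ * C.deficit fstar (snocRound p) + C.totalErr fstar (snocRound p) =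
        (γ * C.deficit fstar p.1 + C.totalErr fstar p.1) + C.roundGap fstar γ p.1 p.2.1 := by
    intro p
    rw [deficit_snocRound, totalErr_snocRound, roundGap]
    ring
  rw [iterLaw, integral_map measurable_snocRound.aemeasurable (hmS _).aestronglyMeasurable]
  simp_rw [hsum]
  rw [integral_add hif hiG, Measure.integral_compProd hif, Measure.integral_compProd hiG]
  congr 1
  · refine integral_congr_ae ?_
    filter_upwards [hκt] with past h
    simp only [integral_const, measureReal_def, h, ENNReal.toReal_one, one_smul]
  · refine integral_congr_ae (.of_forall fun past => ?_)
    have hmp : Measurable fun x : 𝓗 × (Fin H → Traj O A H) => C.roundGap fstar γ past x.1 :=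
      hmG.comp (f := fun x : 𝓗 × (Fin H → Traj O A H) => (past, x)) measurable_prodMk_left
    have hip : Integrable (fun x : 𝓗 × (Fin H → Traj O A H) => C.roundGap fstar γ past x.1)
        (C.roundKernel fstar p₀ (1 / 2) γ t past) :=
      Integrable.of_bound hmp.aestronglyMeasurable (γ + t * H)
        (.of_forall fun x => C.abs_roundGap_le fstar γ hγ past x.1)
    simp only
    rw [roundKernel] at hip ⊢
    rw [ProbabilityTheory.integral_compProd hip]
    simp

theorem integral_potential_le (hγ : 0 ≤ γ) {ε : ℝ} (hε : 0 ≤ ε)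
    (hB : p₀ (C.nearby fstar ε) ≠ 0) (T : ℕ) :
    ∀ t ≤ T, ∫ run, (γ * C.deficit fstar run + C.totalErr fstar run)
        ∂(iterLaw (C.roundKernel fstar p₀ (1 / 2) γ) t) ≤
      t * (γ * ε + T * (H * (ε / 2)) - Real.log (p₀ (C.nearby fstar ε)).toReal) := by
  intro t
  induction t with
  | zero =>
    intro _
    simp [iterLaw, deficit, totalErr]
  | succ t ih =>
    intro ht
    rw [C.integral_potential_succ fstar p₀ γ hγ hε hB t]
    have h1 := ih (by omega)
    have h2 := C.integral_roundGap_le fstar p₀ γ hγ hε hB t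
    -- Bounding the number of past rounds by T gives every round the same cost.
    have h3 : (t : ℝ) * (H * (ε / 2)) ≤ T * (H * (ε / 2)) := by
      have : (t : ℝ) ≤ T := by exact_mod_cast (by omega : t ≤ T)
      gcongr
    push_cast
    linarith

theorem log_toReal_measure_nonpos (B : Set 𝓗) : Real.log (p₀ B).toReal ≤ 0 :=
  Real.log_nonpos ENNReal.toReal_nonneg
    (ENNReal.toReal_le_of_le_ofReal zero_le_one (by simpa using prob_le_one))

/-- The infimum need not be attained, so ε is chosen up to a slack. A finite value excludes null
sets, for which -log 0 = ∞. -/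
theorem exists_nearby_of_omega_lt {c : ℝ} (hω : C.omega fstar p₀ c ≠ ⊤) {r : ℝ}
    (hr : (C.omega fstar p₀ c).toReal < r) :
    ∃ ε > 0, p₀ (C.nearby fstar ε) ≠ 0 ∧
      c * ε - Real.log (p₀ (C.nearby fstar ε)).toReal < r := by
  have h : C.omega fstar p₀ c < (r : EReal) :=
    (EReal.le_coe_toReal hω).trans_lt (by exact_mod_cast hr)
  rw [omega, iInf_lt_iff] at h
  obtain ⟨ε, h⟩ := h
  rw [iInf_lt_iff] at h
  obtain ⟨hε, h⟩ := h
  have hB : p₀ (C.nearby fstar ε) ≠ 0 := by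
    intro h0
    rw [h0, ENNReal.log_zero, EReal.coe_sub_bot] at h
    exact not_top_lt h
  refine ⟨ε, hε, hB, ?_⟩
  rw [ENNReal.log_pos_real hB (measure_ne_top _ _)] at h
  exact_mod_cast h

theorem omega_nonneg {c : ℝ} (hc : 0 ≤ c) : 0 ≤ C.omega fstar p₀ c := by
  refine le_iInf₂ fun ε hε => ?_
  rcases eq_or_ne (p₀ (C.nearby fstar ε)) 0 with h0 | h0
  · rw [h0, ENNReal.log_zero, EReal.coe_sub_bot]
    exact le_top
  · rw [ENNReal.log_pos_real h0 (measure_ne_top _ _)]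
    have h1 := log_toReal_measure_nonpos p₀ (C.nearby fstar ε)
    have h2 : 0 ≤ c * ε - Real.log (p₀ (C.nearby fstar ε)).toReal := by
      have := mul_nonneg hc hε.le
      linarith
    exact_mod_cast h2

theorem isProbabilityMeasure_runLaw (hγ : 0 ≤ γ) {c : ℝ} (hω : C.omega fstar p₀ c ≠ ⊤) (T : ℕ) :
    IsProbabilityMeasure (C.runLaw fstar p₀ (1 / 2) γ T) := by
  obtain ⟨ε, hε, hB, -⟩ := C.exists_nearby_of_omega_lt fstar p₀ hω (lt_add_one _)
  rw [runLaw_eq_iterLaw]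
  exact (C.isProbabilityMeasure_iterLaw fstar p₀ γ hγ hε.le hB T).1 T le_rfl

/-- The potential of `T` rounds is controlled by `ω`. -/
theorem integral_potential_le_omega (hγ : 0 ≤ γ) {T : ℕ} (hγT : γ ≤ H * T)
    (hω : C.omega fstar p₀ (H * T) ≠ ⊤) :
    γ * ∫ run, C.deficit fstar run ∂(C.runLaw fstar p₀ (1 / 2) γ T) +
      ∫ run, C.totalErr fstar run ∂(C.runLaw fstar p₀ (1 / 2) γ T) ≤
      3 / 2 * T * (C.omega fstar p₀ (H * T)).toReal := by
  rw [runLaw_eq_iterLaw, ← integral_const_mul, ← integral_add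
    ((C.integrable_of_abs_le fstar p₀ γ (C.measurable_deficit fstar T)
      (C.abs_deficit_le fstar)).const_mul γ)
    (C.integrable_of_abs_le fstar p₀ γ (C.measurable_totalErr fstar T) (c := H * (T * T))
      fun run => by
        rw [abs_of_nonneg (C.totalErr_nonneg fstar run)]; exact C.totalErr_le fstar run)]
  refine le_of_forall_pos_le_add fun δ hδ => ?_
  have hT : (0 : ℝ) < 3 / 2 * T + 1 := by positivity
  obtain ⟨ε, hε, hB, hlt⟩ := C.exists_nearby_of_omega_lt fstar p₀ hω
    (lt_add_of_pos_right _ (div_pos hδ hT))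
  refine (C.integral_potential_le fstar p₀ γ hγ hε.le hB T T le_rfl).trans ?_
  have h1 := log_toReal_measure_nonpos p₀ (C.nearby fstar ε)
  have h2 : γ * ε ≤ H * T * ε := mul_le_mul_of_nonneg_right hγT hε.le
  -- The constant 3/2: γ + TH/2 ≤ (3/2) HT because γ ≤ HT, and -log p⁰ ≥ 0 may be enlarged by the
  -- same factor.
  have h3 : γ * ε + T * (H * (ε / 2)) - Real.log (p₀ (C.nearby fstar ε)).toReal ≤
      3 / 2 * ((C.omega fstar p₀ (H * T)).toReal + δ / (3 / 2 * T + 1)) := by linarith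
  have h4 : 3 / 2 * T * (δ / (3 / 2 * T + 1)) ≤ δ := by
    rw [mul_div_assoc', div_le_iff₀ hT]
    nlinarith
  calc _ ≤ T * (3 / 2 * ((C.omega fstar p₀ (H * T)).toReal + δ / (3 / 2 * T + 1))) := by gcongr
    _ = 3 / 2 * T * (C.omega fstar p₀ (H * T)).toReal + 3 / 2 * T * (δ / (3 / 2 * T + 1)) := by ring
    _ ≤ _ := by linarith

theorem ae_roundKernel_fst {η : ℝ} {t : ℕ} (past : Fin t → 𝓗 × (Fin H → Traj O A H))
    {p : 𝓗 → Prop} (hp : MeasurableSet {f | p f}) (h : ∀ᵐ f ∂p₀, p f) :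
    ∀ᵐ x ∂(C.roundKernel fstar p₀ η γ t past), p x.1 := by
  have hm : MeasurableSet {x : 𝓗 × (Fin H → Traj O A H) | ¬p x.1} := measurable_fst hp.compl
  rw [ae_iff, ← lintegral_indicator_one hm,
    lintegral_roundKernel _ _ _ _ _ _ (measurable_one.indicator hm),
    lintegral_eq_zero_of_ae_eq_zero]
  rw [posteriorKernel_apply']
  filter_upwards [(withDensity_absolutelyContinuous p₀ _).ae_le h] with f hf
  refine lintegral_eq_zero_of_ae_eq_zero (.of_forall fun D => ?_)
  simp [hf]

/-- If ω = 0, there are arbitrarily small ε for which 𝓗(ε) has prior mass arbitrarily close to 1, so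
almost every f satisfies V_f ≥ V^*. -/
theorem ae_optValue_le_of_omega_eq_zero {c : ℝ} (hc : 0 < c) (hω : C.omega fstar p₀ c ≠ ⊤)
    (h0 : (C.omega fstar p₀ c).toReal = 0) :
    ∀ᵐ f ∂p₀, (C.model fstar).optValue ≤ (C.model f).optValue := by
  have key : ∀ n : ℕ, ∀ᵐ f ∂p₀,
      (C.model fstar).optValue - (C.model f).optValue ≤ 1 / ((n : ℝ) + 1) := by
    intro n
    set S : Set 𝓗 := {f | (C.model fstar).optValue - (C.model f).optValue ≤ 1 / ((n : ℝ) + 1)}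
    have hS : MeasurableSet S :=
      measurableSet_le (C.measurable_optValue.const_sub _) measurable_const
    have hreal : p₀.real Sᶜ ≤ 0 := by
      refine le_of_forall_pos_le_add fun δ hδ => ?_
      have hr : (C.omega fstar p₀ c).toReal < min δ (c * (1 / ((n : ℝ) + 1))) := by
        rw [h0]; positivity
      obtain ⟨ε, hε, hB, hlt⟩ := C.exists_nearby_of_omega_lt fstar p₀ hω hr
      have h1 := log_toReal_measure_nonpos p₀ (C.nearby fstar ε)
      have h2 : c * ε < c * (1 / ((n : ℝ) + 1)) := by
        linarith [min_le_right δ (c * (1 / ((n : ℝ) + 1)))]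
      have h3 : C.nearby fstar ε ⊆ S := fun f hf =>
        hf.1.trans (lt_of_mul_lt_mul_left h2 hc.le).le
      have h4 : p₀.real (C.nearby fstar ε) ≤ p₀.real S := measureReal_mono h3
      have h5 := Real.log_le_sub_one_of_pos (ENNReal.toReal_pos hB (measure_ne_top _ _))
      have h6 := mul_pos hc hε
      rw [probReal_compl_eq_one_sub hS]
      rw [measureReal_def] at h4
      linarith [min_le_left δ (c * (1 / ((n : ℝ) + 1)))]
    exact (measureReal_eq_zero_iff).1 (le_antisymm hreal measureReal_nonneg)
  filter_upwards [ae_all_iff.2 key] with f hf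
  have := ge_of_tendsto' tendsto_one_div_add_atTop_nhds_zero_nat hf
  linarith

/-- Needed when γ = 0: the potential then carries no information about the values. Each posterior is
absolutely continuous with respect to the prior, so all sampled hypotheses are optimistic. -/
theorem integral_deficit_nonpos {c : ℝ} (hc : 0 < c)
    (hω : C.omega fstar p₀ c ≠ ⊤) (h0 : (C.omega fstar p₀ c).toReal = 0) (T : ℕ) :
    ∫ run, C.deficit fstar run ∂(C.runLaw fstar p₀ (1 / 2) γ T) ≤ 0 := by
  have hp : MeasurableSet {f | (C.model fstar).optValue ≤ (C.model f).optValue} :=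
    measurableSet_le measurable_const C.measurable_optValue
  have := ae_iterLaw (κ := C.roundKernel fstar p₀ (1 / 2) γ)
    (p := fun x => (C.model fstar).optValue ≤ (C.model x.1).optValue) (measurable_fst hp)
    (fun t past => C.ae_roundKernel_fst fstar p₀ γ past hp
      (C.ae_optValue_le_of_omega_eq_zero fstar p₀ hc hω h0)) T
  rw [runLaw_eq_iterLaw]
  refine integral_nonpos_of_ae ?_
  filter_upwards [this] with run h
  exact Finset.sum_nonpos fun s _ => sub_nonpos.2 (h s)

/-- The infimum is attained because the admissible d form a closed set. The set is non-empty, since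
the infimum of the empty set is 0 by default and d is positive. -/
theorem gec_mem (T : ℕ) (hd : 0 < C.gec fstar T) (f : Fin T → 𝓗) :
    ∑ t, ((C.model (f t)).optValue - (C.model fstar).value (C.optPolicy (f t))) ≤
      √(C.gec fstar T * ∑ h : Fin H, ∑ t : Fin T, ∑ s ∈ Finset.Iio t,
        C.trainErr fstar (f t) (f s) h) + √(C.gec fstar T * H * T) := by
  have hne : {d : ℝ | 0 ≤ d ∧ ∀ f : Fin T → 𝓗,
    ∑ t, ((C.model (f t)).optValue - (C.model fstar).value (C.optPolicy (f t))) ≤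
      √(d * ∑ h : Fin H, ∑ t : Fin T, ∑ s ∈ Finset.Iio t, C.trainErr fstar (f t) (f s) h) +
      √(d * H * T)}.Nonempty := by
    by_contra h
    rw [Set.not_nonempty_iff_eq_empty] at h
    rw [gec, h, Real.sInf_empty] at hd
    exact lt_irrefl _ hd
  refine (IsClosed.csInf_mem ?_ hne ⟨0, fun d hd => hd.1⟩).2 f
  rw [Set.ofPred_and, Set.ofPred_forall]
  refine (isClosed_le continuous_const continuous_id).inter (isClosed_iInter fun f => ?_)
  exact isClosed_le continuous_const (by fun_prop)

/-- With no steps or no rounds, d = 0 is admissible; positivity of the GEC therefore yields H ≥ 1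
and T ≥ 1. -/
theorem gec_nonpos {T : ℕ} (h : H = 0 ∨ T = 0) : C.gec fstar T ≤ 0 := by
  refine csInf_le ⟨0, fun d hd => hd.1⟩ ⟨le_rfl, fun f => ?_⟩
  rcases h with rfl | rfl
  · simp [C.optValue_eq, Model.value]
  · simp

theorem integral_regret_le (hγ : 0 ≤ γ) {c : ℝ} (hω : C.omega fstar p₀ c ≠ ⊤) {T : ℕ}
    (hd : 0 < C.gec fstar T) {m : ℝ} (hm : 0 < m) :
    C.expectedRegret fstar p₀ (1 / 2) γ T ≤
      ∫ run, C.deficit fstar run ∂(C.runLaw fstar p₀ (1 / 2) γ T) +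
      (∫ run, C.totalErr fstar run ∂(C.runLaw fstar p₀ (1 / 2) γ T)) / m +
      C.gec fstar T * m / 4 + √(C.gec fstar T * H * T) := by
  have := C.isProbabilityMeasure_runLaw fstar p₀ γ hγ hω T
  set d := C.gec fstar T
  have hir : Integrable (fun run => C.regret fstar run) (C.runLaw fstar p₀ (1 / 2) γ T) := by
    rw [runLaw_eq_iterLaw]
    refine C.integrable_of_abs_le fstar p₀ γ (C.measurable_regret fstar T) (c := T) fun run => ?_
    rw [abs_of_nonneg (C.regret_nonneg fstar run)]
    exact C.regret_le fstar run
  have hid : Integrable (fun run => C.deficit fstar run) (C.runLaw fstar p₀ (1 / 2) γ T) := by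
    rw [runLaw_eq_iterLaw]
    exact C.integrable_of_abs_le fstar p₀ γ (C.measurable_deficit fstar T) (C.abs_deficit_le fstar)
  have hie : Integrable (fun run => C.totalErr fstar run) (C.runLaw fstar p₀ (1 / 2) γ T) := by
    rw [runLaw_eq_iterLaw]
    refine C.integrable_of_abs_le fstar p₀ γ (C.measurable_totalErr fstar T) (c := H * (T * T))
      fun run => ?_
    rw [abs_of_nonneg (C.totalErr_nonneg fstar run)]
    exact C.totalErr_le fstar run
  have hpt : ∀ run : Fin T → 𝓗 × (Fin H → Traj O A H), C.regret fstar run ≤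
      C.deficit fstar run + C.totalErr fstar run / m + (d * m / 4 + √(d * H * T)) := by
    intro run
    have h1 := C.gec_mem fstar T hd fun t => (run t).1
    have h2 : C.regret fstar run = C.deficit fstar run + ∑ t, ((C.model (run t).1).optValue -
        (C.model fstar).value (C.optPolicy (run t).1)) := by
      rw [regret, deficit, ← Finset.sum_add_distrib]
      exact Finset.sum_congr rfl fun _ _ => by ring
    -- The inequality of arithmetic and geometric means linearizes the root, so that expectations
    -- can be taken. The parameter m will be γ, or tend to 0 when γ = 0.
    have h3 : √(d * C.totalErr fstar run) ≤ C.totalErr fstar run / m + d * m / 4 := by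
      have hE := C.totalErr_nonneg fstar run
      refine Real.sqrt_le_iff.2 ⟨by positivity, ?_⟩
      have : d * C.totalErr fstar run = 4 * (C.totalErr fstar run / m) * (d * m / 4) := by
        field_simp
      nlinarith [sq_nonneg (C.totalErr fstar run / m - d * m / 4)]
    rw [h2]
    change _ ≤ √(d * C.totalErr fstar run) + _ at h1
    linarith
  have hint := integral_mono hir ((hid.add (hie.div_const m)).add (integrable_const _)) hpt
  rw [integral_add' (hid.add (hie.div_const m)) (integrable_const _),
    integral_add' hid (hie.div_const m), integral_div, integral_const, probReal_univ, one_smul]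
    at hint
  change ∫ run, C.regret fstar run ∂_ ≤ _
  linarith

theorem expectedRegret_le_rounds (hγ : 0 ≤ γ) {c : ℝ} (hω : C.omega fstar p₀ c ≠ ⊤) (T : ℕ) :
    C.expectedRegret fstar p₀ (1 / 2) γ T ≤ T := by
  have := C.isProbabilityMeasure_runLaw fstar p₀ γ hγ hω T
  refine (integral_mono_of_nonneg (.of_forall fun run => C.regret_nonneg fstar run)
    (integrable_const (T : ℝ)) (.of_forall fun run => C.regret_le fstar run)).trans ?_
  rw [integral_const, probReal_univ, one_smul]

/-- The regret bound from which the bounds for rounds and for episodes follow. -/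
theorem expectedRegret_le {T : ℕ} (hω : C.omega fstar p₀ (H * T) ≠ ⊤)
    (hd : 0 < C.gec fstar T)
    (hγ : γ = 2 * √((C.omega fstar p₀ (H * T)).toReal * T / C.gec fstar T))
    (hγ_le : 1 ≤ C.gec fstar T ∨ γ ≤ H * T / 2) :
    C.expectedRegret fstar p₀ (1 / 2) γ T ≤
      2 * √(C.gec fstar T * T * (H + (C.omega fstar p₀ (H * T)).toReal)) := by
  have hH : (1 : ℝ) ≤ H := by
    have : H ≠ 0 := fun h => (C.gec_nonpos fstar (T := T) (.inl h)).not_gt hd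
    exact_mod_cast Nat.one_le_iff_ne_zero.2 this
  have hT : (1 : ℝ) ≤ T := by
    have : T ≠ 0 := fun h => (C.gec_nonpos fstar (T := T) (.inr h)).not_gt hd
    exact_mod_cast Nat.one_le_iff_ne_zero.2 this
  have hHT : (0 : ℝ) < H * T := by positivity
  have hω0 : 0 ≤ (C.omega fstar p₀ (H * T)).toReal :=
    EReal.toReal_nonneg (C.omega_nonneg fstar p₀ hHT.le)
  have hγ0 : 0 ≤ γ := by rw [hγ]; positivity
  have hgen := fun m => C.integral_regret_le fstar p₀ γ hγ0 hω hd (m := m)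
  have htriv := C.expectedRegret_le_rounds fstar p₀ γ hγ0 hω T
  have hpot := C.integral_potential_le_omega fstar p₀ γ hγ0 (T := T)
  set d := C.gec fstar T
  set ω := (C.omega fstar p₀ (H * T)).toReal
  set R := C.expectedRegret fstar p₀ (1 / 2) γ T
  have hγsq : γ ^ 2 * d = 4 * (ω * T) := by
    rw [hγ, mul_pow, Real.sq_sqrt (by positivity)]
    field_simp
    ring
  rcases le_or_gt γ (H * T) with hγT | hγT
  · have hpot := hpot hγT hω
    have hmain : R ≤ 5 / 8 * (d * γ) + √(d * H * T) := by
      rcases hγ0.eq_or_lt with h0 | h0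
      · have hω1 : ω = 0 := by
          rw [← h0] at hγsq
          have : ω * T = 0 := by linarith
          rcases mul_eq_zero.1 this with h | h
          · exact h
          · linarith
        have hdef := C.integral_deficit_nonpos fstar p₀ γ hHT hω hω1 T
        rw [hω1, ← h0, zero_mul, mul_zero, zero_add] at hpot
        rw [← h0, mul_zero, mul_zero, zero_add]
        rw [← h0] at hdef hgen
        refine le_of_forall_pos_le_add fun δ hδ => ?_
        -- For γ = 0 both expectations are at most 0, so m may be as small as desired; this choice
        -- makes dm/4 = δ.
        have h1 := hgen (4 * δ / d) (by positivity)
        have h2 := div_nonpos_of_nonpos_of_nonneg hpot (by positivity : 0 ≤ 4 * δ / d)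
        have h3 : d * (4 * δ / d) / 4 = δ := by field_simp
        linarith
      · have h1 := hgen γ h0
        have h2 := div_le_div_of_nonneg_right hpot hγ0
        rw [add_div, mul_div_cancel_left₀ _ h0.ne'] at h2
        -- From γ² d = 4ωT; the term dγ/4 raises the coefficient to 5/8.
        have h3 : 3 / 2 * T * ω / γ = 3 / 8 * (d * γ) := by
          field_simp
          linarith
        linarith
    refine hmain.trans ?_
    rw [← div_le_iff₀' two_pos]
    refine Real.le_sqrt_of_sq_le ?_
    have h1 : √(d * H * T) ^ 2 = d * H * T := Real.sq_sqrt (by positivity)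
    have h2 : (d * γ) ^ 2 = 4 * (d * (ω * T)) := by
      calc (d * γ) ^ 2 = d * (γ ^ 2 * d) := by ring
        _ = _ := by rw [hγsq]; ring
    have h4 : 0 ≤ d * (ω * T) := by positivity
    have h5 : 0 ≤ d * H * T := by positivity
    -- Cauchy–Schwarz for (5/4) a + b with a = dγ/2 and b = √(dHT): the constant 25/16 + 1 stays
    -- below 4.
    nlinarith [sq_nonneg (d * γ / 2 - 5 / 4 * √(d * H * T))]
  -- For γ > HT the alternative γ ≤ HT/2 is impossible. Then T² ≤ γ² ≤ γ² d² = 4dωT, so the trivial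
  -- bound T suffices.
  · have hd1 : 1 ≤ d := by
      rcases hγ_le with h | h
      · exact h
      · linarith
    have hγT' : (T : ℝ) ≤ γ := by nlinarith
    refine htriv.trans ?_
    rw [← div_le_iff₀' two_pos]
    refine Real.le_sqrt_of_sq_le ?_
    have h1 : (T : ℝ) ^ 2 ≤ γ ^ 2 := by gcongr
    have h2 : γ ^ 2 ≤ d * (γ ^ 2 * d) := by
      nlinarith [sq_nonneg γ, mul_le_mul hd1 hd1 zero_le_one hd.le]
    rw [hγsq] at h2
    have h3 : 0 ≤ d * T * H := by positivity
    linarith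

theorem mem_nearby_self {ε : ℝ} (hε : 0 ≤ ε) : fstar ∈ C.nearby fstar ε :=
  ⟨by simpa using hε, fun π => by simp [InformationTheory.klDiv_self]⟩

/-- The true model lies in 𝓗(ε) for every ε > 0, so this set has mass at least 1/|𝓗|; then ε tends
to 0. -/
theorem omega_le_log_card [Finite 𝓗] [MeasurableSingletonClass 𝓗]
    (hp₀ : p₀ = uniformOn Set.univ) {c : ℝ} (hc : 0 ≤ c) :
    (C.omega fstar p₀ c).toReal ≤ Real.log (Nat.card 𝓗) := by
  have := Fintype.ofFinite 𝓗
  have : Nonempty 𝓗 := ⟨fstar⟩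
  have hcard : (0 : ℝ) < Nat.card 𝓗 := by exact_mod_cast Nat.card_pos
  refine le_of_forall_pos_le_add fun δ hδ => ?_
  -- The choice ε = δ/(c + 1) gives cε ≤ δ even when c = 0.
  have hc1 : 0 < c + 1 := by positivity
  have hε : 0 < δ / (c + 1) := by positivity
  have hsingle : p₀ {fstar} = ENNReal.ofReal (Nat.card 𝓗 : ℝ)⁻¹ := by
    rw [hp₀, uniformOn_univ, ENNReal.ofReal_inv_of_pos hcard]
    simp [Nat.card_eq_fintype_card]
  have hle : (Nat.card 𝓗 : ℝ)⁻¹ ≤ (p₀ (C.nearby fstar (δ / (c + 1)))).toReal := by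
    rw [ENNReal.ofReal_le_iff_le_toReal (measure_ne_top _ _) |>.symm, ← hsingle]
    exact measure_mono (Set.singleton_subset_iff.2 (C.mem_nearby_self fstar hε.le))
  have hB : p₀ (C.nearby fstar (δ / (c + 1))) ≠ 0 := by
    intro h0
    rw [h0, ENNReal.toReal_zero] at hle
    exact absurd hle (not_le.2 (inv_pos.2 hcard))
  have hω : C.omega fstar p₀ c ≤
      ((c * (δ / (c + 1)) - Real.log (p₀ (C.nearby fstar (δ / (c + 1)))).toReal : ℝ) : EReal) := by
    refine (iInf₂_le _ hε).trans (le_of_eq ?_)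
    rw [ENNReal.log_pos_real hB (measure_ne_top _ _)]
    norm_cast
  have h1 := EReal.toReal_le_toReal hω
    (ne_bot_of_le_ne_bot (by simp) (C.omega_nonneg fstar p₀ hc)) (EReal.coe_ne_top _)
  rw [EReal.toReal_coe] at h1
  have h2 := Real.log_le_log (inv_pos.2 hcard) hle
  rw [Real.log_inv] at h2
  have h3 : c * (δ / (c + 1)) ≤ δ := by
    rw [mul_div_assoc', div_le_iff₀ hc1]
    nlinarith
  linarith

end PSRClass

/-- A bound on the regret of rounds gives both forms of the final bound. -/
theorem regret_forms {R d H T L : ℝ} (hd : 0 ≤ d) (hH : 1 ≤ H) (hT : 0 ≤ T) (hL : 0 ≤ L)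
    (h : R ≤ 2 * √(d * T * (H + L))) :
    R ≤ 2 * √(d * (H * T) * (H + L)) ∧ H * R ≤ 2 * √(d * H * (H * T) * (H + L)) := by
  have hX : 0 ≤ d * T * (H + L) := by positivity
  constructor
  · refine h.trans ?_
    have : d * T * (H + L) ≤ d * (H * T) * (H + L) := by nlinarith
    gcongr
  -- Counting each round H times loses nothing: H moves under the root as H². The form for rounds
  -- instead gives away a factor √H.
  · have e : d * H * (H * T) * (H + L) = H ^ 2 * (d * T * (H + L)) := by ring
    rw [e, Real.sqrt_mul (sq_nonneg H), Real.sqrt_sq (by linarith)]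
    nlinarith

end PSR

end

theorem mainTheorem3 {𝓗 O A : Type*} [MeasurableSpace 𝓗] [MeasurableSpace O]
    [MeasurableSpace A] [DiscreteMeasurableSpace A] [Fintype A] [Nonempty A]
    (ν : Measure O) [SigmaFinite ν] (H T : ℕ)
    (C : PSR.PSRClass 𝓗 ν A H) (fstar : 𝓗)
    (p₀ : Measure 𝓗) [IsProbabilityMeasure p₀]
    (hω : C.omega fstar p₀ (H * T) ≠ ⊤)
    (d γ : ℝ) (hd : d = C.gec fstar T) (hd_pos : 0 < d)
    (hγ : γ = 2 * √((C.omega fstar p₀ (H * T)).toReal * T / d))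
    (hγ_le : 1 ≤ d ∨ γ ≤ H * T / 2) :
    IsProbabilityMeasure (C.runLaw fstar p₀ (1 / 2) γ T) ∧
    -- one summand of the regret for each of the `T` rounds
    C.expectedRegret fstar p₀ (1 / 2) γ T ≤
      2 * √(d * (H * T) * (H + (C.omega fstar p₀ (H * T)).toReal)) ∧
    -- one summand for each of the `H * T` executed episodes
    H * C.expectedRegret fstar p₀ (1 / 2) γ T ≤
      2 * √(d * H * (H * T) * (H + (C.omega fstar p₀ (H * T)).toReal)) ∧
    -- finite model classes
    (Finite 𝓗 → MeasurableSingletonClass 𝓗 → p₀ = uniformOn Set.univ →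
      C.expectedRegret fstar p₀ (1 / 2) γ T ≤
        2 * √(d * (H * T) * (H + Real.log (Nat.card 𝓗))) ∧
      H * C.expectedRegret fstar p₀ (1 / 2) γ T ≤
        2 * √(d * H * (H * T) * (H + Real.log (Nat.card 𝓗)))) := by
  subst hd
  have hHT : (0 : ℝ) ≤ H * T := by positivity
  have hH : (1 : ℝ) ≤ H := by
    have : H ≠ 0 := fun h => (C.gec_nonpos fstar (T := T) (.inl h)).not_gt hd_pos
    exact_mod_cast Nat.one_le_iff_ne_zero.2 this
  have hω0 : 0 ≤ (C.omega fstar p₀ (H * T)).toReal :=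
    EReal.toReal_nonneg (C.omega_nonneg fstar p₀ hHT)
  have hR := C.expectedRegret_le fstar p₀ γ hω hd_pos hγ hγ_le
  obtain ⟨h1, h2⟩ := PSR.regret_forms hd_pos.le hH T.cast_nonneg hω0 hR
  refine ⟨C.isProbabilityMeasure_runLaw fstar p₀ γ (by rw [hγ]; positivity) hω T, h1, h2, ?_⟩
  intro _ _ hp₀
  have hle := C.omega_le_log_card fstar p₀ hp₀ hHT
  refine PSR.regret_forms hd_pos.le hH T.cast_nonneg (hω0.trans hle) (hR.trans ?_)
  gcongr
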